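/- Let $$P=\begin{pmatrix}3&3&5&4\\1&2&3&3\\1&1&2&1\\2&3&5&5\end{pmatrix},\qquad Q=\begin{pmatrix}1&0&0&0\\0&1&1&0\\0&0&1&1\\0&1&0&0\end{pmatrix},$$ let $\nu$ be the probability eigenvector with positive entries associated with the Perron--Frobenius eigenvalue $\eta$ of $P$, let $\lambda=(\lambda_1,\lambda_2,\lambda_3,\lambda_4)=Q\nu$ and $|\lambda|=\lambda_1+\lambda_2+\lambda_3+\lambda_4$. Put $I_1=[0,\lambda_1)$, $I_2=[\lambda_1,\lambda_1+\lambda_2)$, $I_3=[\lambda_1+\lambda_2,\lambda_1+\lambda_2+\lambda_3)$, $I_4=[\lambda_1+\lambda_2+\lambda_3,|\lambda|]$ and let $T:[0,|\lambda|]\to[0,|\lambda|]$ be $$T(x)=\begin{cases}-x+\lambda_1+\lambda_3,&x\in I_1\\-x+\lambda_1+|\lambda|,&x\in I_2\\-x+\lambda_1+\lambda_2+\lambda_3,&x\in I_3\\-x+\lambda_1+\lambda_3+|\lambda|,&x\in I_4.\end{cases}$$ Let $p_1=0$, $p_2=T(\lambda_1+\lambda_2)$, $p_3=T(\lambda_1+\lambda_2+\lambda_3)$,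 $p_4=|\lambda|$. For $i,j\in\{1,2,3,4\}$ let $c_{ij}=\sum_{k\ge 0,\;T^k(p_j)\in I_i}2^{-k}$, and let $M=(c_{ij}-c_{i4})_{1\le i,j\le 3}$. Let $u=(u_1,\dots,u_4)$ and $\ell=(\ell_1,\dots,\ell_4)$ have positive entries with $\sum_i u_i=1$, $\sum_i\ell_i=\frac12$ and $$\begin{pmatrix}u_1\\u_2\\u_3\end{pmatrix}=M\begin{pmatrix}\ell_1\\\ell_2\\\ell_3\end{pmatrix}+\frac12\begin{pmatrix}c_{14}\\c_{24}\\c_{34}\end{pmatrix}.$$ Let $g=g_{u,\ell}$ be the map $$g(x)=\begin{cases}-\frac x2+\frac{u_1}2+\frac{u_3}2+\ell_1+\ell_2,&x\in[0,u_1)\\-\frac x2+\frac{u_1}2+\frac12+\ell_1+\ell_2+\ell_3,&x\in[u_1,u_1+u_2)\\-\frac x2+\frac{u_1}2+\frac{u_2}2+\frac{u_3}2+\ell_1,&x\in[u_1+u_2,u_1+u_2+u_3)\\-\frac x2+\frac{u_1}2+\frac{u_3}2+\frac12+\ell_1+\ell_2,&x\in[u_1+u_2+u_3,1].\end{cases}$$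 Then $g$ maps $[0,1]$ into itself and is topologically semiconjugate to $T$: there is a continuous, nondecreasing, surjective map $h:[0,1]\to[0,|\lambda|]$ with $h\circ g=T\circ h$. Moreover, the set $\mathcal P=\{T^k(p_i):k\ge0,\,1\le i\le4\}$ is a countably infinite dense subset of $[0,|\lambda|]$, and $h$ can be chosen so that it collapses exactly one gap for each point of $\mathcal P$: $h^{-1}(\{p\})$ is a compact interval for every $p\in\mathcal P$, of length $\ell_i$ if $p=p_i$ $(1\le i\le 4)$, $\ell_i/2^k$ if $p=T^k(p_i)$ with $i\in\{2,3\}$ and $k\ge1$, and $(\ell_1+\ell_4)/2^k$ if $p=T^k(p_1)=T^k(p_4)$ with $k\ge1$; and $h^{-1}(\{y\})$ is a single point for every $y\in[0,|\lambda|]\setminus\mathcal P$. -/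

import Mathlib

namespace SwitchedServer

open Set

/-! Indices `1,2,3,4` of the mathematics are `0,1,2,3 : Fin 4` here. -/

/-- The matrix `P`. -/
def matP : Matrix (Fin 4) (Fin 4) ℝ :=
  !![3, 3, 5, 4;
     1, 2, 3, 3;
     1, 1, 2, 1;
     2, 3, 5, 5]

/-- The matrix `Q`. -/
def matQ : Matrix (Fin 4) (Fin 4) ℝ :=
  !![1, 0, 0, 0;
     0, 1, 1, 0;
     0, 0, 1, 1;
     0, 1, 0, 0]

/-- `r` is the Perron-Frobenius eigenvalue of the real matrix `A` (an eigenvalue that is at least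
the modulus of every complex eigenvalue) and `v` is a probability eigenvector for it with
positive entries. -/
structure IsPerronPair (A : Matrix (Fin 4) (Fin 4) ℝ) (r : ℝ) (v : Fin 4 → ℝ) : Prop where
  pos : ∀ i, 0 < v i
  sum_eq_one : ∑ i, v i = 1
  eigen : A.mulVec v = r • v
  dominant : ∀ z ∈ spectrum ℂ (A.map (algebraMap ℝ ℂ)), ‖z‖ ≤ r

/-- For a nonnegative matrix, a positive eigenvector belongs to a dominant eigenvalue. -/
theorem norm_le_of_pos_eigenvector (A : Matrix (Fin 4) (Fin 4) ℝ) (hA : ∀ i j, 0 ≤ A i j)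
    (r : ℝ) (v : Fin 4 → ℝ) (hv : ∀ i, 0 < v i) (h : A.mulVec v = r • v) :
    ∀ z ∈ spectrum ℂ (A.map (algebraMap ℝ ℂ)), ‖z‖ ≤ r := by
  intro z hz
  rw [← Matrix.spectrum_toLin', ← Module.End.hasEigenvalue_iff_mem_spectrum] at hz
  obtain ⟨w, hw⟩ := hz.exists_hasEigenvector
  have hw0 : w ≠ 0 := hw.2
  have hwe := hw.apply_eq_smul
  rw [Matrix.toLin'_apply] at hwe
  obtain ⟨i, -, hi⟩ := Finset.exists_max_image Finset.univ (fun i => ‖w i‖ / v i)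
    ⟨0, Finset.mem_univ _⟩
  have hb : ∀ j, ‖w j‖ ≤ ‖w i‖ / v i * v j := fun j => by
    have := hi j (Finset.mem_univ _)
    rwa [div_le_iff₀ (hv j)] at this
  have hwi : 0 < ‖w i‖ := by
    by_contra hcon
    have h0 : ‖w i‖ = 0 := le_antisymm (not_lt.mp hcon) (norm_nonneg _)
    apply hw0
    funext j
    have := hb j
    rw [h0] at this
    simpa using this
  have h1 : z * w i = ∑ j, (A i j : ℂ) * w j := by
    have := congrFun hwe i
    simpa [Matrix.mulVec, dotProduct] using this.symm
  have h2 : ∑ j, A i j * v j = r * v i := by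
    have := congrFun h i
    simpa [Matrix.mulVec, dotProduct] using this
  have h3 : ‖z‖ * ‖w i‖ ≤ r * ‖w i‖ := by
    calc ‖z‖ * ‖w i‖ = ‖∑ j, (A i j : ℂ) * w j‖ := by rw [← norm_mul, h1]
      _ ≤ ∑ j, ‖(A i j : ℂ) * w j‖ := norm_sum_le _ _
      _ = ∑ j, A i j * ‖w j‖ := by
          refine Finset.sum_congr rfl fun j _ => ?_
          rw [norm_mul, Complex.norm_real, Real.norm_of_nonneg (hA i j)]
      _ ≤ ∑ j, A i j * (‖w i‖ / v i * v j) :=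
          Finset.sum_le_sum fun j _ => mul_le_mul_of_nonneg_left (hb j) (hA i j)
      _ = ‖w i‖ / v i * ∑ j, A i j * v j := by
          rw [Finset.mul_sum]
          exact Finset.sum_congr rfl fun j _ => by ring
      _ = r * ‖w i‖ := by
          rw [h2]
          field_simp [(hv i).ne']
  exact le_of_mul_le_mul_right h3 hwi

theorem exists_isPerronPair : ∃ q : ℝ × (Fin 4 → ℝ), IsPerronPair matP q.1 q.2 := by
  have hc : ContinuousOn (fun t : ℝ => t ^ 3 - 11 * t ^ 2 + 7 * t - 1) (Icc 10.33 10.34) := by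
    fun_prop
  obtain ⟨t, ⟨ht1, ht2⟩, ht⟩ := intermediate_value_Icc (by norm_num) hc
    (show (0 : ℝ) ∈ Icc _ _ by constructor <;> norm_num)
  simp only at ht
  have hpos : ∀ i, 0 < (![(-3 * t ^ 2 + 32 * t - 9) / 4, (5 * t ^ 2 - 54 * t + 25) / 4,
      (t ^ 2 - 10 * t - 3) / 4, (-3 * t ^ 2 + 32 * t - 9) / 4] : Fin 4 → ℝ) i := by
    intro i
    fin_cases i <;> simp <;> nlinarith
  have hsum : ∑ i, (![(-3 * t ^ 2 + 32 * t - 9) / 4, (5 * t ^ 2 - 54 * t + 25) / 4,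
      (t ^ 2 - 10 * t - 3) / 4, (-3 * t ^ 2 + 32 * t - 9) / 4] : Fin 4 → ℝ) i = 1 := by
    rw [Fin.sum_univ_four]
    simp
    ring
  have heig : matP.mulVec ![(-3 * t ^ 2 + 32 * t - 9) / 4, (5 * t ^ 2 - 54 * t + 25) / 4,
      (t ^ 2 - 10 * t - 3) / 4, (-3 * t ^ 2 + 32 * t - 9) / 4] =
      t • ![(-3 * t ^ 2 + 32 * t - 9) / 4, (5 * t ^ 2 - 54 * t + 25) / 4,
      (t ^ 2 - 10 * t - 3) / 4, (-3 * t ^ 2 + 32 * t - 9) / 4] := by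
    funext i
    fin_cases i <;> simp [matP, Matrix.mulVec, dotProduct, Fin.sum_univ_four]
    · linear_combination (3 / 4 : ℝ) * ht
    · linear_combination (-5 / 4 : ℝ) * ht
    · linear_combination (-1 / 4 : ℝ) * ht
    · linear_combination (3 / 4 : ℝ) * ht
  refine ⟨(t, _), hpos, hsum, heig, norm_le_of_pos_eigenvector matP ?_ t _ hpos heig⟩
  intro i j
  fin_cases i <;> fin_cases j <;> simp [matP]

/-- The Perron-Frobenius eigenvalue `η` of `P`. -/
noncomputable def eta : ℝ := exists_isPerronPair.choose.1

/-- The probability eigenvector `ν` of `P` with positive entries associated with `η`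
(it is unique because all entries of `P` are positive). -/
noncomputable def nu : Fin 4 → ℝ := exists_isPerronPair.choose.2

theorem isPerronPair_eta_nu : IsPerronPair matP eta nu := exists_isPerronPair.choose_spec

/-- The length vector `λ = Q ν`. -/
noncomputable def lam : Fin 4 → ℝ := matQ.mulVec nu

/-- `|λ| = λ₁ + λ₂ + λ₃ + λ₄`. -/
noncomputable def lamNorm : ℝ := ∑ i, lam i

/-- The partition `I₁, I₂, I₃, I₄` of `[0, |λ|]`. -/
noncomputable def intervalI : Fin 4 → Set ℝ :=
  ![Ico 0 (lam 0),
    Ico (lam 0) (lam 0 + lam 1),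
    Ico (lam 0 + lam 1) (lam 0 + lam 1 + lam 2),
    Icc (lam 0 + lam 1 + lam 2) lamNorm]

/-- The isometric model `T`; only its values on `[0, |λ|]` are meaningful. -/
noncomputable def isoT (x : ℝ) : ℝ :=
  if x < lam 0 then -x + lam 0 + lam 2
  else if x < lam 0 + lam 1 then -x + lam 0 + lamNorm
  else if x < lam 0 + lam 1 + lam 2 then -x + lam 0 + lam 1 + lam 2
  else -x + lam 0 + lam 2 + lamNorm

/-- The points `p₁, p₂, p₃, p₄`. -/
noncomputable def pt : Fin 4 → ℝ :=
  ![0, isoT (lam 0 + lam 1), isoT (lam 0 + lam 1 + lam 2), lamNorm]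

/-- `K i j = {k ≥ 0 : T^k(p_j) ∈ I_i}`. -/
def setK (i j : Fin 4) : Set ℕ := {k | isoT^[k] (pt j) ∈ intervalI i}

/-- `c i j = ∑_{k ∈ K i j} 1 / 2^k`. -/
noncomputable def coeffC (i j : Fin 4) : ℝ := ∑' k : setK i j, 1 / (2 : ℝ) ^ (k : ℕ)

/-- The `3 × 3` matrix `M`, with entries `c i j - c i 4`. -/
noncomputable def matM : Matrix (Fin 3) (Fin 3) ℝ :=
  Matrix.of fun i j => coeffC i.castSucc j.castSucc - coeffC i.castSucc 3

/-- The piecewise affine map `g_{u,ℓ}` with all slopes `-1/2`; only its values on `[0, 1]` are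
meaningful. -/
noncomputable def mapG (u l : Fin 4 → ℝ) (x : ℝ) : ℝ :=
  if x < u 0 then -x / 2 + u 0 / 2 + u 2 / 2 + l 0 + l 1
  else if x < u 0 + u 1 then -x / 2 + u 0 / 2 + 1 / 2 + l 0 + l 1 + l 2
  else if x < u 0 + u 1 + u 2 then -x / 2 + u 0 / 2 + u 1 / 2 + u 2 / 2 + l 0
  else -x / 2 + u 0 / 2 + u 2 / 2 + 1 / 2 + l 0 + l 1

/-- `h` is a topological semiconjugacy from the self-map `f` of `[0, 1]` to the self-map `S` of
`[0, a]`: a continuous, surjective, nondecreasing map `[0, 1] → [0, a]` with `h ∘ f = S ∘ h`. -/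
structure IsSemiconjugacy (a : ℝ) (f S h : ℝ → ℝ) : Prop where
  mapsTo_source : MapsTo f (Icc 0 1) (Icc 0 1)
  mapsTo_target : MapsTo S (Icc 0 a) (Icc 0 a)
  continuousOn : ContinuousOn h (Icc 0 1)
  monotoneOn : MonotoneOn h (Icc 0 1)
  image_eq : h '' Icc 0 1 = Icc 0 a
  comm : ∀ x ∈ Icc (0 : ℝ) 1, h (f x) = S (h x)

/-- The union `{T^k(p_i) : k ≥ 0, 1 ≤ i ≤ 4}` of the `T`-orbits of `p₁, …, p₄`. -/
def orbitSet : Set ℝ := {x | ∃ (i : Fin 4) (k : ℕ), x = isoT^[k] (pt i)}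

/-- The length of the gap inserted at `T^k(p_i)`: it is `ℓ_i` for `k = 0`, and `ℓ_i / 2^k` for
`k ≥ 1`, except that `T^k(p₁) = T^k(p₄)` for `k ≥ 1`, where the two contributions add up. -/
noncomputable def gapLength (l : Fin 4 → ℝ) (i : Fin 4) (k : ℕ) : ℝ :=
  if k = 0 then l i
  else (if i = 0 ∨ i = 3 then l 0 + l 3 else l i) / 2 ^ k

end SwitchedServer

/-! ### Orbits of the isometric model and the collapsing semiconjugacy -/

namespace SwitchedServer

open Set Filter Topology

/-! ### The lattice spanned by the entries of `nu` -/

/-! Let μ = ∑_j ℓ_j ∑_k 2^(-k) δ_{T^k(p_j)} (`mass`). Its total mass is 2 ∑ ℓ_j = 1, and splitting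
off the terms k = 0 gives μ = ∑_j ℓ_j δ_{p_j} + ½ T_*μ (`mass_eq_add`). The map h (`collapse`) is
the generalized inverse of the distribution function of μ: its fibre over y is [μ(-∞,y), μ(-∞,y]],
so atoms become gaps. The equation linking u and ℓ says u_i = μ(I_i). Since every branch of T
reverses orientation, the identity for μ evaluated on half-lines ending at T(y) yields exactly the
affine formulas for g, with slope -½ (`mapG_mem_fiber`).

Two facts about T are needed. Density of the orbits makes μ charge every interval, so distinct
fibres are disjoint. Knowing all coincidences among the orbits gives the sizes of the atoms
(`mass_singleton`).

Both come from self-similarity. The first return map R of T to [0,1) is an exchange of four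
intervals with flips, of lengths ν_i, and its first return to [0,1/η) is R rescaled by 1/η, with P
counting visits (`itinerary_word`, `follow_word`, `reach_retT`). The orbits of p₂, p₃, p₄ enter
[0,1/η^n) for the first time at e_j/η^n with three distinct e_j, so they are infinite and disjoint
(`eq_of_iterate_eq`). The rescaled cells and their R-images tile [0,1), so approximation by orbit
points improves by the factor η at each level (`exists_retOrbit_near`). All required inequalities
concern integer combinations of the ν_i and are decided by integer arithmetic. -/

theorem eta_nu (i : Fin 4) : ∑ j, matP i j * nu j = eta * nu i := by
  have := congrFun isPerronPair_eta_nu.eigen i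
  simpa [Matrix.mulVec, dotProduct] using this

theorem nu_pos (i : Fin 4) : 0 < nu i := isPerronPair_eta_nu.pos i

theorem one_lt_eta : 1 < eta := by
  have h := eta_nu 0
  simp [matP, Fin.sum_univ_four] at h
  have h0 := nu_pos 0
  have h1 := nu_pos 1
  have h2 := nu_pos 2
  have h3 := nu_pos 3
  by_contra hc
  have : eta * nu 0 ≤ 1 * nu 0 := mul_le_mul_of_nonneg_right (not_lt.mp hc) h0.le
  linarith

theorem eta_pos : 0 < eta := one_pos.trans one_lt_eta

/-- The first and last rows of `matP` differ by (1, 0, 0, -1), so η fixes ν₁ - ν₄, while η ≠ 1.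
Three integer coordinates therefore suffice below. -/
theorem nu_three : nu 3 = nu 0 := by
  have h0 := eta_nu 0
  have h3 := eta_nu 3
  simp [matP, Fin.sum_univ_four] at h0 h3
  have h : (eta - 1) * (nu 3 - nu 0) = 0 := by linear_combination h0 - h3
  rcases mul_eq_zero.mp h with h | h
  · linarith [one_lt_eta]
  · linarith

theorem nu_sum : 2 * nu 0 + nu 1 + nu 2 = 1 := by
  have := isPerronPair_eta_nu.sum_eq_one
  rw [Fin.sum_univ_four, nu_three] at this
  linarith

theorem lam_zero : lam 0 = nu 0 := by
  simp [lam, matQ, Matrix.mulVec, dotProduct, Fin.sum_univ_four]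

theorem lam_one : lam 1 = nu 1 + nu 2 := by
  simp [lam, matQ, Matrix.mulVec, dotProduct, Fin.sum_univ_four]

theorem lam_two : lam 2 = nu 0 + nu 2 := by
  simp [lam, matQ, Matrix.mulVec, dotProduct, Fin.sum_univ_four, nu_three]
  ring

theorem lam_three : lam 3 = nu 1 := by
  simp [lam, matQ, Matrix.mulVec, dotProduct, Fin.sum_univ_four]

theorem lamNorm_eq : lamNorm = 2 * nu 0 + 2 * nu 1 + 2 * nu 2 := by
  rw [lamNorm, Fin.sum_univ_four, lam_zero, lam_one, lam_two, lam_three]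
  ring

/-- Integer coordinates with respect to `nu 0, nu 1, nu 2`. -/
abbrev Lat := ℤ × ℤ × ℤ

/-- The real number with given integer coordinates. -/
noncomputable def ev (v : Lat) : ℝ := v.1 * nu 0 + v.2.1 * nu 1 + v.2.2 * nu 2

/-- Multiplication by `eta` in coordinates. -/
def mulEta (v : Lat) : Lat :=
  (7 * v.1 + 4 * v.2.1 + 2 * v.2.2, 3 * v.1 + 2 * v.2.1 + v.2.2, 5 * v.1 + 3 * v.2.1 + 2 * v.2.2)

/-- Division by `eta` in coordinates. -/
def divEta (v : Lat) : Lat :=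
  (v.1 - 2 * v.2.1, -v.1 + 4 * v.2.1 - v.2.2, -v.1 - v.2.1 + 2 * v.2.2)

theorem ev_mulEta (v : Lat) : ev (mulEta v) = eta * ev v := by
  have h0 := eta_nu 0
  have h1 := eta_nu 1
  have h2 := eta_nu 2
  simp [matP, Fin.sum_univ_four, nu_three] at h0 h1 h2
  simp only [ev, mulEta]
  push_cast
  linear_combination (v.1 : ℝ) * h0 + (v.2.1 : ℝ) * h1 + (v.2.2 : ℝ) * h2

/-- Multiplication by η has determinant 1 in these coordinates, so its inverse is integral. -/
theorem mulEta_divEta (v : Lat) : mulEta (divEta v) = v := by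
  ext <;> simp only [mulEta, divEta] <;> ring

theorem ev_divEta (v : Lat) : ev (divEta v) = ev v / eta := by
  rw [eq_div_iff eta_pos.ne', mul_comm, ← ev_mulEta, mulEta_divEta]

theorem ev_add (v w : Lat) : ev (v + w) = ev v + ev w := by
  simp only [ev, Prod.fst_add, Prod.snd_add]
  push_cast
  ring

theorem ev_sub (v w : Lat) : ev (v - w) = ev v - ev w := by
  simp only [ev, Prod.fst_sub, Prod.snd_sub]
  push_cast
  ring

/-- A sufficient condition for `0 < ev v`. -/
def latPos (v : Lat) : Bool :=
  let w := mulEta (mulEta (mulEta (mulEta v)))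
  decide (0 < w.1) && decide (0 < w.2.1) && decide (0 < w.2.2)

/-- Multiplying by η^4 preserves the sign and pushes coordinates towards the Perron direction; four
steps are enough for every comparison certified below. -/
theorem ev_pos_of_latPos {v : Lat} (h : latPos v = true) : 0 < ev v := by
  simp only [latPos, Bool.and_eq_true, decide_eq_true_eq] at h
  obtain ⟨⟨h1, h2⟩, h3⟩ := h
  have key : 0 < ev (mulEta (mulEta (mulEta (mulEta v)))) := by
    have h1' : (0 : ℝ) < ((mulEta (mulEta (mulEta (mulEta v)))).1 : ℝ) := by exact_mod_cast h1
    have h2' : (0 : ℝ) < ((mulEta (mulEta (mulEta (mulEta v)))).2.1 : ℝ) := by exact_mod_cast h2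
    have h3' : (0 : ℝ) < ((mulEta (mulEta (mulEta (mulEta v)))).2.2 : ℝ) := by exact_mod_cast h3
    rw [ev]
    have := mul_pos h1' (nu_pos 0)
    have := mul_pos h2' (nu_pos 1)
    have := mul_pos h3' (nu_pos 2)
    linarith
  simp only [ev_mulEta] at key
  have e := eta_pos
  exact (mul_pos_iff_of_pos_left e).1 ((mul_pos_iff_of_pos_left e).1
    ((mul_pos_iff_of_pos_left e).1 ((mul_pos_iff_of_pos_left e).1 key)))

def latLt (v w : Lat) : Bool := latPos (w - v)

def latLe (v w : Lat) : Bool := decide (v = w) || latPos (w - v)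

theorem ev_lt_of_latLt {v w : Lat} (h : latLt v w = true) : ev v < ev w := by
  have := ev_pos_of_latPos h
  rw [ev_sub] at this
  linarith

theorem ev_le_of_latLe {v w : Lat} (h : latLe v w = true) : ev v ≤ ev w := by
  simp only [latLe, Bool.or_eq_true, decide_eq_true_eq] at h
  rcases h with rfl | h
  · exact le_rfl
  · exact (ev_lt_of_latLt h).le

/-! ### The first return map to `[0, 1)` -/

/-- The left endpoints of the cells of the return map. -/
def lo : Fin 4 → Lat
  | 0 => (0, 0, 0)
  | 1 => (1, 0, 0)
  | 2 => (1, 1, 0)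
  | 3 => (1, 1, 1)

/-- The right endpoints of the cells of the return map. -/
def hi : Fin 4 → Lat
  | 0 => (1, 0, 0)
  | 1 => (1, 1, 0)
  | 2 => (1, 1, 1)
  | 3 => (2, 1, 1)

/-- The branches of the return map in coordinates. -/
def latBranch : Fin 4 → Lat → Lat
  | 0, v => (2, 0, 1) - v
  | 1, v => v + (1, 0, 1)
  | 2, v => v - (1, 1, 0)
  | 3, v => (2, 1, 2) - v

/-- The branches of the return map. -/
noncomputable def branch : Fin 4 → ℝ → ℝ
  | 0, x => ev (2, 0, 1) - x
  | 1, x => x + ev (1, 0, 1)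
  | 2, x => x - ev (1, 1, 0)
  | 3, x => ev (2, 1, 2) - x

/-- The open cells of continuity of the return map. -/
def cell (i : Fin 4) : Set ℝ := Ioo (ev (lo i)) (ev (hi i))

/-- The first return map of `isoT` to `[0, 1)`. -/
noncomputable def retT (x : ℝ) : ℝ :=
  if x < ev (hi 0) then branch 0 x
  else if x < ev (hi 1) then branch 1 x
  else if x < ev (hi 2) then branch 2 x
  else branch 3 x

theorem ev_latBranch (i : Fin 4) (v : Lat) : ev (latBranch i v) = branch i (ev v) := by
  fin_cases i <;> simp only [latBranch, branch, ev_add, ev_sub]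

theorem hi_zero_le_hi_one : ev (hi 0) ≤ ev (hi 1) := ev_le_of_latLe (by decide +kernel)

theorem hi_one_le_hi_two : ev (hi 1) ≤ ev (hi 2) := ev_le_of_latLe (by decide +kernel)

theorem retT_of_mem_cell {i : Fin 4} {x : ℝ} (hx : x ∈ cell i) : retT x = branch i x := by
  have h1 := hi_zero_le_hi_one
  have h2 := hi_one_le_hi_two
  obtain ⟨hl, hr⟩ := hx
  have e1 : lo 1 = hi 0 := rfl
  have e2 : lo 2 = hi 1 := rfl
  have e3 : lo 3 = hi 2 := rfl
  fin_cases i <;> simp only [Fin.mk_zero, Fin.mk_one, Fin.reduceFinMk, e1, e2, e3] at hl hr ⊢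
  · rw [retT, if_pos hr]
  · rw [retT, if_neg hl.le.not_gt, if_pos hr]
  · rw [retT, if_neg (h1.trans hl.le).not_gt, if_neg hl.le.not_gt, if_pos hr]
  · rw [retT, if_neg (h1.trans (h2.trans hl.le)).not_gt, if_neg (h2.trans hl.le).not_gt,
      if_neg hl.le.not_gt]

/-- The point at parameter `t` on the segment with lattice endpoints. -/
noncomputable def seg (v w : Lat) (t : ℝ) : ℝ := (1 - t) * ev v + t * ev w

theorem branch_seg (i : Fin 4) (v w : Lat) (t : ℝ) :
    branch i (seg v w t) = seg (latBranch i v) (latBranch i w) t := by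
  simp only [seg, ev_latBranch]
  fin_cases i <;> simp only [branch] <;> ring

theorem seg_self (v : Lat) (t : ℝ) : seg v v t = ev v := by
  simp only [seg]; ring

theorem seg_divEta (v w : Lat) (t : ℝ) : seg (divEta v) (divEta w) t = seg v w t / eta := by
  simp only [seg, ev_divEta]; ring

/-- A sufficient condition for an open segment (or a point) to lie in a cell. -/
def inCell (i : Fin 4) (v w : Lat) : Bool :=
  latLe (lo i) v && latLe (lo i) w && (latLt (lo i) v || latLt (lo i) w) &&
    latLe v (hi i) && latLe w (hi i) && (latLt v (hi i) || latLt w (hi i))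

theorem seg_pos {t x y : ℝ} (ht : t ∈ Ioo (0 : ℝ) 1) (hx : 0 ≤ x) (hy : 0 ≤ y)
    (h : 0 < x ∨ 0 < y) : 0 < (1 - t) * x + t * y := by
  obtain ⟨h0, h1⟩ := ht
  have h1' : 0 < 1 - t := by linarith
  rcases h with h | h
  · have := mul_pos h1' h
    have := mul_nonneg h0.le hy
    linarith
  · have := mul_pos h0 h
    have := mul_nonneg h1'.le hx
    linarith

/-- One strict inequality per side suffices for interior parameters. The case v = w is allowed, so
single points are followed by the same certificates as intervals. -/
theorem seg_mem_cell {i : Fin 4} {v w : Lat} {t : ℝ} (h : inCell i v w = true)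
    (ht : t ∈ Ioo (0 : ℝ) 1) : seg v w t ∈ cell i := by
  simp only [inCell, Bool.and_eq_true, Bool.or_eq_true] at h
  obtain ⟨⟨⟨⟨⟨h1, h2⟩, h3⟩, h4⟩, h5⟩, h6⟩ := h
  have h1 := ev_le_of_latLe h1
  have h2 := ev_le_of_latLe h2
  have h4 := ev_le_of_latLe h4
  have h5 := ev_le_of_latLe h5
  have h3 : 0 < ev v - ev (lo i) ∨ 0 < ev w - ev (lo i) :=
    h3.imp (fun h => sub_pos.2 (ev_lt_of_latLt h)) (fun h => sub_pos.2 (ev_lt_of_latLt h))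
  have h6 : 0 < ev (hi i) - ev v ∨ 0 < ev (hi i) - ev w :=
    h6.imp (fun h => sub_pos.2 (ev_lt_of_latLt h)) (fun h => sub_pos.2 (ev_lt_of_latLt h))
  have a := seg_pos ht (sub_nonneg.2 h1) (sub_nonneg.2 h2) h3
  have b := seg_pos ht (sub_nonneg.2 h4) (sub_nonneg.2 h5) h6
  constructor <;> simp only [seg] <;> linarith

theorem exists_seg_of_mem_Ioo {v w : Lat} {x : ℝ} (hx : x ∈ Ioo (ev v) (ev w)) :
    ∃ t ∈ Ioo (0 : ℝ) 1, x = seg v w t := by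
  obtain ⟨h1, h2⟩ := hx
  have h : 0 < ev w - ev v := by linarith
  refine ⟨(x - ev v) / (ev w - ev v), ⟨div_pos (by linarith) h, (div_lt_one h).2 (by linarith)⟩, ?_⟩
  simp only [seg]
  field_simp
  ring

theorem exists_seg_of_mem_Icc {v w : Lat} {x : ℝ} (hx : x ∈ Icc (ev v) (ev w)) :
    ∃ t ∈ Icc (0 : ℝ) 1, x = seg v w t := by
  rw [← segment_eq_Icc (hx.1.trans hx.2)] at hx
  obtain ⟨s, t, hs, ht, hst, rfl⟩ := hx
  refine ⟨t, ⟨ht, by linarith⟩, ?_⟩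
  simp only [seg, smul_eq_mul]
  rw [← hst]
  ring

/-- The endpoint of a segment transported along a word. -/
def follow : List (Fin 4) → Lat → Lat
  | [], v => v
  | i :: w, v => follow w (latBranch i v)

/-- Certifies that the word is the itinerary of the open segment and that no intermediate
segment meets `[0, 1 / eta)`. -/
def itinerary : List (Fin 4) → Lat → Lat → Bool
  | [], _, _ => true
  | i :: w, v, v' => inCell i v v' && (w.isEmpty || (latLe (divEta (2, 1, 1)) (latBranch i v) &&
      latLe (divEta (2, 1, 1)) (latBranch i v'))) && itinerary w (latBranch i v) (latBranch i v')

theorem retT_iterate_seg {t : ℝ} (ht : t ∈ Ioo (0 : ℝ) 1) : ∀ (w : List (Fin 4)) (v v' : Lat),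
    itinerary w v v' = true → retT^[w.length] (seg v v' t) = seg (follow w v) (follow w v') t
  | [], _, _, _ => rfl
  | i :: w, v, v', h => by
    simp only [itinerary, Bool.and_eq_true] at h
    rw [List.length_cons, Function.iterate_succ_apply, retT_of_mem_cell (seg_mem_cell h.1.1 ht),
      branch_seg, follow, follow, retT_iterate_seg ht w _ _ h.2]

/-- The itinerary of the `i`-th cell divided by `eta` until its return to `[0, 1 / eta)`. -/
def word : Fin 4 → List (Fin 4)
  | 0 => [0, 3, 0, 1, 3, 0, 2]
  | 1 => [0, 3, 1, 3, 0, 1, 3, 0, 2]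
  | 2 => [0, 3, 1, 3, 0, 1, 3, 0, 2, 0, 3, 1, 3, 0, 2]
  | 3 => [0, 3, 1, 3, 0, 1, 3, 0, 3, 1, 3, 0, 2]

/-- The letter j occurs `matP j i` times in `word i`: this is how P governs the dynamics. -/
theorem itinerary_word (i : Fin 4) :
    itinerary (word i) (divEta (lo i)) (divEta (hi i)) = true := by
  revert i; decide +kernel

theorem word_ne_nil (i : Fin 4) : word i ≠ [] := by
  fin_cases i <;> simp [word]

/-- The renormalization identity: R iterated along `word i` acts on the rescaled cell as R does on
the cell itself, up to the factor 1/η. -/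
theorem follow_word (i : Fin 4) :
    follow (word i) (divEta (lo i)) = divEta (latBranch i (lo i)) ∧
    follow (word i) (divEta (hi i)) = divEta (latBranch i (hi i)) := by
  revert i; decide +kernel

/-! ### Renormalization -/

/-- Some positive iterate of `f` takes `x` to `y`, and no earlier positive iterate is below
`δ`. -/
def Reach (f : ℝ → ℝ) (δ x y : ℝ) : Prop :=
  ∃ r, 0 < r ∧ f^[r] x = y ∧ ∀ k, 0 < k → k < r → δ ≤ f^[k] x

theorem Reach.mono {f : ℝ → ℝ} {δ δ' x y : ℝ} (h : Reach f δ x y) (hd : δ' ≤ δ) :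
    Reach f δ' x y := by
  obtain ⟨r, h0, h1, h2⟩ := h
  exact ⟨r, h0, h1, fun k hk hk' => hd.trans (h2 k hk hk')⟩

theorem Reach.trans {f : ℝ → ℝ} {δ x y z : ℝ} (h : Reach f δ x y) (hy : δ ≤ y)
    (h' : Reach f δ y z) : Reach f δ x z := by
  obtain ⟨r, h0, h1, h2⟩ := h
  obtain ⟨s, k0, k1, k2⟩ := h'
  refine ⟨s + r, by omega, by rw [Function.iterate_add_apply, h1, k1], fun k hk hk' => ?_⟩
  rcases lt_trichotomy k r with h | h | h
  · exact h2 k hk h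
  · rw [h, h1]; exact hy
  · obtain ⟨m, rfl⟩ := Nat.exists_eq_add_of_lt h
    rw [show r + m + 1 = (m + 1) + r by ring, Function.iterate_add_apply, h1]
    exact k2 _ (by omega) (by omega)

/-- Cells 0 and 3 return after one step. Cells 1 and 2 lie in I₂, which T sends above 1, and they
return at the second step. -/
theorem reach_retT_zero {i : Fin 4} {x : ℝ} (hx : x ∈ cell i) : Reach isoT 1 x (retT x) := by
  rw [retT_of_mem_cell hx]
  have h0 := nu_pos 0
  have h1 := nu_pos 1
  have h2 := nu_pos 2
  have hs := nu_sum
  obtain ⟨hl, hr⟩ := hx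
  fin_cases i <;> simp [lo, hi, ev] at hl hr
  · refine ⟨1, one_pos, ?_, fun k _ _ => by omega⟩
    simp only [Function.iterate_one, isoT, branch, lam_zero, lam_two, ev]
    rw [if_pos hr]
    push_cast; ring
  · have e : isoT x = -x + lam 0 + lamNorm := by
      rw [isoT, if_neg (by rw [lam_zero]; linarith), if_pos (by rw [lam_zero, lam_one]; linarith)]
    refine ⟨2, two_pos, ?_, fun k _ _ => ?_⟩
    · rw [Function.iterate_succ_apply, Function.iterate_one, e]
      simp only [isoT, branch, lam_zero, lam_one, lam_two, ev, lamNorm_eq]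
      rw [if_neg (by linarith), if_neg (by linarith), if_neg (by linarith)]
      push_cast; ring
    · obtain rfl : k = 1 := by omega
      rw [Function.iterate_one, e, lam_zero, lamNorm_eq]
      linarith
  · have e : isoT x = -x + lam 0 + lamNorm := by
      rw [isoT, if_neg (by rw [lam_zero]; linarith), if_pos (by rw [lam_zero, lam_one]; linarith)]
    refine ⟨2, two_pos, ?_, fun k _ _ => ?_⟩
    · rw [Function.iterate_succ_apply, Function.iterate_one, e]
      simp only [isoT, branch, lam_zero, lam_one, lam_two, ev, lamNorm_eq]
      rw [if_neg (by linarith), if_neg (by linarith), if_pos (by linarith)]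
      push_cast; ring
    · obtain rfl : k = 1 := by omega
      rw [Function.iterate_one, e, lam_zero, lamNorm_eq]
      linarith
  · refine ⟨1, one_pos, ?_, fun k _ _ => by omega⟩
    simp only [Function.iterate_one, isoT, branch, lam_zero, lam_one, lam_two, ev]
    rw [if_neg (by linarith), if_neg (by linarith), if_pos (by linarith)]
    push_cast; ring

theorem ev_one : ev (2, 1, 1) = 1 := by
  have := nu_sum
  simp only [ev]; push_cast; linarith

theorem one_div_pow_eta_le {t : ℝ} (ht : t ∈ Ioo (0 : ℝ) 1) {v w : Lat} (n : ℕ)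
    (hv : latLe (divEta (2, 1, 1)) v = true) (hw : latLe (divEta (2, 1, 1)) w = true) :
    1 / eta ^ (n + 1) ≤ seg v w t / eta ^ n := by
  have hv := ev_le_of_latLe hv
  have hw := ev_le_of_latLe hw
  rw [ev_divEta, ev_one] at hv hw
  have hs : 1 / eta ≤ seg v w t := by
    simp only [seg]
    have := mul_le_mul_of_nonneg_left hv (show 0 ≤ 1 - t by linarith [ht.2])
    have := mul_le_mul_of_nonneg_left hw ht.1.le
    linarith
  rw [pow_succ', ← div_div]
  exact div_le_div_of_nonneg_right hs (pow_pos eta_pos n).le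

/-- Each letter contributes a path of T at level n; these paths can be concatenated because the
certified intermediate points stay above 1/η before rescaling. -/
theorem reach_of_itinerary {n : ℕ}
    (H : ∀ i, ∀ x ∈ cell i, Reach isoT (1 / eta ^ n) (x / eta ^ n) (retT x / eta ^ n))
    {t : ℝ} (ht : t ∈ Ioo (0 : ℝ) 1) : ∀ (w : List (Fin 4)) (v v' : Lat), w ≠ [] →
    itinerary w v v' = true → Reach isoT (1 / eta ^ (n + 1)) (seg v v' t / eta ^ n)
      (seg (follow w v) (follow w v') t / eta ^ n)
  | [], _, _, h, _ => absurd rfl h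
  | i :: w, v, v', _, h => by
    simp only [itinerary, Bool.and_eq_true, Bool.or_eq_true] at h
    obtain ⟨⟨hc, hw⟩, h⟩ := h
    have h1 := H i _ (seg_mem_cell hc ht)
    rw [retT_of_mem_cell (seg_mem_cell hc ht), branch_seg] at h1
    have h1 := h1.mono (one_div_le_one_div_of_le (pow_pos eta_pos n)
      (pow_le_pow_right₀ one_lt_eta.le n.le_succ))
    rcases w with _ | ⟨j, w⟩
    · exact h1
    · rcases hw with hw | hw
      · simp at hw
      · exact h1.trans (one_div_pow_eta_le ht n hw.1 hw.2)
          (reach_of_itinerary H ht (j :: w) _ _ (by simp) h)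

theorem reach_retT (n : ℕ) : ∀ i, ∀ x ∈ cell i,
    Reach isoT (1 / eta ^ n) (x / eta ^ n) (retT x / eta ^ n) := by
  induction n with
  | zero =>
    intro i x hx
    simpa using reach_retT_zero hx
  | succ n ih =>
    intro i x hx
    obtain ⟨t, ht, rfl⟩ := exists_seg_of_mem_Ioo hx
    have := reach_of_itinerary ih ht _ _ _ (word_ne_nil i) (itinerary_word i)
    rw [(follow_word i).1, (follow_word i).2, seg_divEta, seg_divEta, div_div, div_div,
      ← pow_succ'] at this
    rwa [retT_of_mem_cell hx, branch_seg]

/-- The first points of the orbits of `p₂, p₃, p₄` in `[0, 1)`. -/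
def entry : Fin 3 → Lat
  | 0 => (1, 0, 1)
  | 1 => (0, 0, 1)
  | 2 => (2, 0, 1)

/-- The itinerary of an entry point `p` until `p / eta`. -/
def entryWord : Fin 3 → List (Fin 4)
  | 0 => [1, 3, 0, 2]
  | 1 => [0, 3, 1, 3, 0, 2]
  | 2 => [3, 0, 1, 3, 0, 2]

theorem itinerary_entryWord (j : Fin 3) :
    itinerary (entryWord j) (entry j) (entry j) = true := by
  revert j; decide +kernel

theorem entryWord_ne_nil (j : Fin 3) : entryWord j ≠ [] := by
  fin_cases j <;> simp [entryWord]

/-- Each entry point is self-similar: its own R-orbit passes through its rescaled copy. -/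
theorem follow_entryWord (j : Fin 3) : follow (entryWord j) (entry j) = divEta (entry j) := by
  revert j; decide +kernel

theorem ev_entry_lt_one (j : Fin 3) : ev (entry j) < 1 := by
  rw [← ev_one]
  apply ev_lt_of_latLt
  revert j; decide +kernel

theorem ev_entry_le_entry (j : Fin 3) : 1 / eta ≤ ev (entry j) := by
  rw [← ev_one, ← ev_divEta]
  apply ev_le_of_latLe
  revert j; decide +kernel

theorem ev_entry_injective {i j : Fin 3} (h : ev (entry i) = ev (entry j)) : i = j := by
  have h0 := nu_pos 0
  fin_cases i <;> fin_cases j <;> simp [entry, ev] at h ⊢ <;> linarith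

theorem reach_entry (n : ℕ) (j : Fin 3) :
    Reach isoT (1 / eta ^ (n + 1)) (ev (entry j) / eta ^ n) (ev (entry j) / eta ^ (n + 1)) := by
  have := reach_of_itinerary (reach_retT n) (t := 1 / 2) ⟨by norm_num, by norm_num⟩ _ _ _
    (entryWord_ne_nil j) (itinerary_entryWord j)
  rw [seg_self, follow_entryWord, seg_self, ev_divEta, div_div, ← pow_succ'] at this
  exact this

/-! ### Distinguished points, first visits and coincidences of orbits -/

theorem pt_zero : pt 0 = 0 := rfl

theorem pt_one : pt 1 = nu 0 + nu 2 := by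
  have h0 := nu_pos 0
  have h1 := nu_pos 1
  have h2 := nu_pos 2
  simp only [pt, isoT, lam_zero, lam_one, lam_two, Matrix.cons_val]
  rw [if_neg (by linarith), if_neg (by linarith), if_pos (by linarith)]
  ring

theorem pt_two : pt 2 = 1 := by
  have h0 := nu_pos 0
  have h1 := nu_pos 1
  have h2 := nu_pos 2
  have hs := nu_sum
  simp only [pt, isoT, lam_zero, lam_one, lam_two, lamNorm_eq, Matrix.cons_val]
  rw [if_neg (by linarith), if_neg (by linarith), if_neg (by linarith)]
  linarith

theorem pt_three : pt 3 = lamNorm := rfl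

theorem isoT_one : isoT 1 = nu 2 := by
  have h0 := nu_pos 0
  have h1 := nu_pos 1
  have h2 := nu_pos 2
  have hs := nu_sum
  simp only [isoT, lam_zero, lam_one, lam_two]
  rw [if_neg (by linarith), if_neg (by linarith), if_pos (by linarith)]
  linarith

theorem isoT_lamNorm : isoT lamNorm = 2 * nu 0 + nu 2 := by
  have h0 := nu_pos 0
  have h1 := nu_pos 1
  have h2 := nu_pos 2
  simp only [isoT, lam_zero, lam_one, lam_two, lamNorm_eq]
  rw [if_neg (by linarith), if_neg (by linarith), if_neg (by linarith)]
  ring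

theorem isoT_zero : isoT 0 = 2 * nu 0 + nu 2 := by
  simp only [isoT, lam_zero, lam_two]
  rw [if_pos (nu_pos 0)]
  ring

/-- The first visit of the orbit of `p₂, p₃, p₄` to `[0, 1 / eta ^ n)`. -/
theorem exists_first_visit (n : ℕ) (j : Fin 3) : ∃ f, n ≤ f ∧
    isoT^[f] (pt j.succ) = ev (entry j) / eta ^ n ∧
    ∀ k < f, 1 / eta ^ n ≤ isoT^[k] (pt j.succ) := by
  induction n with
  | zero =>
    have h0 := nu_pos 0
    have h1 := nu_pos 1
    have h2 := nu_pos 2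
    have hs := nu_sum
    fin_cases j
    · exact ⟨0, le_rfl, by simp [pt_one, entry, ev], fun k hk => by omega⟩
    · refine ⟨1, by omega, by simp [pt_two, entry, ev, isoT_one], fun k hk => ?_⟩
      obtain rfl : k = 0 := by omega
      simp [pt_two]
    · refine ⟨1, by omega, ?_, fun k hk => ?_⟩
      · simp [pt_three, entry, ev, isoT_lamNorm]
      · obtain rfl : k = 0 := by omega
        simp [pt_three, lamNorm_eq]
        linarith
  | succ n ih =>
    obtain ⟨f, h1, h2, h3⟩ := ih
    obtain ⟨r, r0, r1, r2⟩ := reach_entry n j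
    have hle : 1 / eta ^ (n + 1) ≤ 1 / eta ^ n := one_div_le_one_div_of_le (pow_pos eta_pos n)
      (pow_le_pow_right₀ one_lt_eta.le n.le_succ)
    -- Each level costs at least one step (`r0`), which maintains `n ≤ f`.
    refine ⟨r + f, by omega, by rw [Function.iterate_add_apply, h2, r1], fun k hk => ?_⟩
    rcases lt_trichotomy k f with h | h | h
    · exact hle.trans (h3 k h)
    · rw [h, h2, pow_succ', ← div_div]
      exact div_le_div_of_nonneg_right (ev_entry_le_entry j) (pow_pos eta_pos n).le
    · obtain ⟨m, rfl⟩ := Nat.exists_eq_add_of_lt h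
      rw [show f + m + 1 = (m + 1) + f by ring, Function.iterate_add_apply, h2]
      exact r2 _ (by omega) (by omega)

/-- The orbits of `p₂, p₃, p₄` are infinite and pairwise disjoint. -/
theorem eq_of_iterate_eq {i j : Fin 3} {k m : ℕ}
    (h : isoT^[k] (pt i.succ) = isoT^[m] (pt j.succ)) : i = j ∧ k = m := by
  -- At level k + m both first visits occur no earlier than times k and m, hence on the common tail.
  -- Being first, they coincide; the entry points then give i = j, and the times give k = m.
  choose f hf1 hf2 hf3 using exists_first_visit (k + m)
  have hlt (j : Fin 3) : ev (entry j) / eta ^ (k + m) < 1 / eta ^ (k + m) :=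
    div_lt_div_of_pos_right (ev_entry_lt_one j) (pow_pos eta_pos _)
  obtain ⟨s, hs⟩ := Nat.exists_eq_add_of_le' ((Nat.le_add_right k m).trans (hf1 i))
  obtain ⟨s', hs'⟩ := Nat.exists_eq_add_of_le' ((Nat.le_add_left m k).trans (hf1 j))
  have ei : isoT^[s] (isoT^[k] (pt i.succ)) = ev (entry i) / eta ^ (k + m) := by
    rw [← Function.iterate_add_apply, ← hs, hf2]
  have ej : isoT^[s'] (isoT^[k] (pt i.succ)) = ev (entry j) / eta ^ (k + m) := by
    rw [h, ← Function.iterate_add_apply, ← hs', hf2]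
  rcases lt_trichotomy s s' with hss | hss | hss
  · have := hf3 j (s + m) (by omega)
    rw [Function.iterate_add_apply, ← h, ei] at this
    exact absurd this (hlt i).not_ge
  · subst hss
    rw [ei] at ej
    obtain rfl : i = j := ev_entry_injective ((div_left_inj' (pow_pos eta_pos _).ne').1 ej)
    exact ⟨rfl, by omega⟩
  · have := hf3 i (s' + k) (by omega)
    rw [Function.iterate_add_apply, ej] at this
    exact absurd this (hlt j).not_ge

/-! ### Density of the orbits -/

/-- The orbits of the entry points under the return map. -/
def retOrbit : Set ℝ := {x | ∃ (j : Fin 3) (m : ℕ), x = retT^[m] (ev (entry j))}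

theorem retT_mem_retOrbit {x : ℝ} (hx : x ∈ retOrbit) : retT x ∈ retOrbit := by
  obtain ⟨j, m, rfl⟩ := hx
  exact ⟨j, m + 1, (Function.iterate_succ_apply' _ _ _).symm⟩

theorem retT_iterate_mem_retOrbit {x : ℝ} (hx : x ∈ retOrbit) (k : ℕ) :
    retT^[k] x ∈ retOrbit := by
  induction k with
  | zero => exact hx
  | succ k ih =>
    rw [Function.iterate_succ_apply']
    exact retT_mem_retOrbit ih

theorem retT_mem_Ioo {i : Fin 4} {x : ℝ} (hx : x ∈ cell i) : retT x ∈ Ioo (0 : ℝ) 1 := by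
  rw [retT_of_mem_cell hx]
  have h0 := nu_pos 0
  have h1 := nu_pos 1
  have h2 := nu_pos 2
  have hs := nu_sum
  obtain ⟨hl, hr⟩ := hx
  fin_cases i <;> simp [lo, hi, ev, branch] at hl hr ⊢ <;> constructor <;> linarith

/-- The orbits of `p₂, p₃, p₄` do not meet the discontinuities. -/
theorem mem_cell_of_orbit {j : Fin 3} {k : ℕ} (h : isoT^[k] (pt j.succ) ∈ Ioo (0 : ℝ) 1) :
    ∃ i, isoT^[k] (pt j.succ) ∈ cell i := by
  have h0 := nu_pos 0
  have h1 := nu_pos 1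
  have h2 := nu_pos 2
  have hs := nu_sum
  -- Each interior discontinuity of R is sent by T to p₄, p₃ or p₂ within two steps, and no orbit
  -- comes back to these points.
  have key (i : Fin 3) (s : ℕ) (hs : 0 < s) : isoT^[s] (isoT^[k] (pt j.succ)) ≠ pt i.succ := by
    intro h
    rw [← Function.iterate_add_apply] at h
    have := (eq_of_iterate_eq (i := j) (j := i) (k := s + k) (m := 0) h).2
    omega
  obtain ⟨hl, hr⟩ := h
  generalize isoT^[k] (pt j.succ) = x at *
  rcases lt_trichotomy x (nu 0) with h | h | h
  · exact ⟨0, by constructor <;> simp [lo, hi, ev] <;> linarith⟩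
  · refine absurd ?_ (key 2 1 one_pos)
    rw [h, show Fin.succ 2 = (3 : Fin 4) from rfl, pt_three, Function.iterate_one, isoT, lam_zero,
      lam_one, if_neg (lt_irrefl _), if_pos (by linarith)]
    ring
  rcases lt_trichotomy x (nu 0 + nu 1) with h' | h' | h'
  · exact ⟨1, by constructor <;> simp [lo, hi, ev] <;> linarith⟩
  · refine absurd ?_ (key 1 2 two_pos)
    rw [h', show Fin.succ 1 = (2 : Fin 4) from rfl, Function.iterate_succ_apply,
      Function.iterate_one]
    have : isoT (nu 0 + nu 1) = lam 0 + lam 1 + lam 2 := by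
      simp only [isoT, lam_zero, lam_one, lam_two, lamNorm_eq]
      rw [if_neg (by linarith), if_pos (by linarith)]
      ring
    rw [this]
    rfl
  rcases lt_trichotomy x (nu 0 + nu 1 + nu 2) with h'' | h'' | h''
  · exact ⟨2, by constructor <;> simp [lo, hi, ev] <;> linarith⟩
  · refine absurd ?_ (key 0 1 one_pos)
    rw [h'', show Fin.succ 0 = (1 : Fin 4) from rfl, Function.iterate_one,
      show nu 0 + nu 1 + nu 2 = lam 0 + lam 1 by rw [lam_zero, lam_one]; ring]
    rfl
  · exact ⟨3, by constructor <;> simp [lo, hi, ev] <;> linarith⟩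

theorem exists_retT_iterate_eq (j : Fin 3) (m : ℕ) :
    ∃ k, retT^[m] (ev (entry j)) = isoT^[k] (pt j.succ) ∧ ∃ i, isoT^[k] (pt j.succ) ∈ cell i := by
  induction m with
  | zero =>
    obtain ⟨f, -, h, -⟩ := exists_first_visit 0 j
    rw [pow_zero, div_one] at h
    refine ⟨f, h.symm, mem_cell_of_orbit ?_⟩
    rw [h]
    exact ⟨(one_div_pos.2 eta_pos).trans_le (ev_entry_le_entry j), ev_entry_lt_one j⟩
  | succ m ih =>
    obtain ⟨k, h1, i, h2⟩ := ih
    obtain ⟨r, -, h, -⟩ := reach_retT_zero h2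
    rw [← Function.iterate_add_apply] at h
    rw [Function.iterate_succ_apply', h1]
    refine ⟨r + k, h.symm, mem_cell_of_orbit ?_⟩
    rw [h]
    exact retT_mem_Ioo h2

theorem exists_mem_cell_of_mem_retOrbit {x : ℝ} (hx : x ∈ retOrbit) : ∃ i, x ∈ cell i := by
  obtain ⟨j, m, rfl⟩ := hx
  obtain ⟨k, h, i, hi⟩ := exists_retT_iterate_eq j m
  exact ⟨i, h ▸ hi⟩

/-! ### Scale invariance of the orbits of the return map -/

theorem retT_iterate_word {i : Fin 4} {x : ℝ} (hx : x ∈ cell i) :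
    retT^[(word i).length] (x / eta) = retT x / eta := by
  obtain ⟨t, ht, rfl⟩ := exists_seg_of_mem_Ioo hx
  rw [← seg_divEta, retT_iterate_seg ht _ _ _ (itinerary_word i), (follow_word i).1,
    (follow_word i).2, retT_of_mem_cell hx, branch_seg, seg_divEta]

theorem div_eta_mem_retOrbit {x : ℝ} (hx : x ∈ retOrbit) : x / eta ∈ retOrbit := by
  obtain ⟨j, m, rfl⟩ := hx
  induction m with
  | zero =>
    refine ⟨j, (entryWord j).length, ?_⟩
    have := retT_iterate_seg (t := 1 / 2) ⟨by norm_num, by norm_num⟩ _ _ _ (itinerary_entryWord j)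
    rw [seg_self, follow_entryWord, seg_self, ev_divEta] at this
    exact this.symm
  | succ m ih =>
    obtain ⟨i, hi⟩ := exists_mem_cell_of_mem_retOrbit ⟨j, m, rfl⟩
    rw [Function.iterate_succ_apply', ← retT_iterate_word hi]
    exact retT_iterate_mem_retOrbit ih _

/-- The floors of the renormalization towers in each cell, in increasing order: `(j, k)` stands
for the `k`-th image of the `j`-th cell divided by `eta`. -/
def floors : Fin 4 → List (Fin 4 × ℕ)
  | 0 => [(0, 0), (1, 0), (2, 0), (3, 0), (2, 9), (3, 7), (2, 7), (1, 7), (0, 5), (3, 11), (2, 13), (3, 4), (2, 4), (1, 4), (0, 2)]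
  | 1 => [(1, 2), (2, 2), (3, 2), (2, 11), (3, 9), (0, 3), (1, 5), (2, 5), (3, 5)]
  | 2 => [(2, 14), (3, 12), (0, 6), (1, 8), (2, 8)]
  | 3 => [(3, 8), (2, 10), (3, 1), (2, 1), (1, 1), (0, 1), (1, 3), (2, 3), (3, 3), (2, 12), (3, 10), (0, 4), (1, 6), (2, 6), (3, 6)]

/-- Certifies that the floors listed cover the cell `i` from the point `v` on. -/
def floorsCover (i : Fin 4) : Lat → List (Fin 4 × ℕ) → Bool
  | v, [] => decide (v = hi i)
  | v, (j, k) :: l =>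
    let e := follow ((word j).take k) (divEta (lo j))
    let e' := follow ((word j).take k) (divEta (hi j))
    itinerary ((word j).take k) (divEta (lo j)) (divEta (hi j)) && inCell i e e' &&
      (decide (e = v) && floorsCover i e' l || decide (e' = v) && floorsCover i e l)

theorem floorsCover_floors (i : Fin 4) : floorsCover i (lo i) (floors i) = true := by
  revert i; decide +kernel

theorem exists_floor {i : Fin 4} {x : ℝ} : ∀ (l : List (Fin 4 × ℕ)) (v : Lat),
    floorsCover i v l = true → x ∈ Icc (ev v) (ev (hi i)) → ev v < ev (hi i) →
    ∃ (j : Fin 4) (w : List (Fin 4)) (t : ℝ), t ∈ Icc (0 : ℝ) 1 ∧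
      itinerary w (divEta (lo j)) (divEta (hi j)) = true ∧
      inCell i (follow w (divEta (lo j))) (follow w (divEta (hi j))) = true ∧
      x = seg (follow w (divEta (lo j))) (follow w (divEta (hi j))) t
  | [], v, h, _, hlt => by
    simp only [floorsCover, decide_eq_true_eq] at h
    exact absurd hlt (by rw [h]; exact lt_irrefl _)
  | (j, k) :: l, v, h, hx, hlt => by
    simp only [floorsCover, Bool.and_eq_true, Bool.or_eq_true, decide_eq_true_eq] at h
    obtain ⟨⟨h1, h2⟩, h | h⟩ := h
    · rcases le_or_gt x (ev (follow ((word j).take k) (divEta (hi j)))) with hle | hgt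
      · rw [← h.1] at hx
        obtain ⟨t, ht, rfl⟩ := exists_seg_of_mem_Icc ⟨hx.1, hle⟩
        exact ⟨j, _, t, ht, h1, h2, rfl⟩
      · exact exists_floor l _ h.2 ⟨hgt.le, hx.2⟩ (hgt.trans_le hx.2)
    · rcases le_or_gt x (ev (follow ((word j).take k) (divEta (lo j)))) with hle | hgt
      · rw [← h.1] at hx
        obtain ⟨t, ht, rfl⟩ := exists_seg_of_mem_Icc ⟨hx.1, hle⟩
        -- This floor is traversed backwards, so the parameter is reversed.
        refine ⟨j, _, 1 - t, ⟨by linarith [ht.2], by linarith [ht.1]⟩, h1, h2, ?_⟩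
        simp only [seg]; ring
      · exact exists_floor l _ h.2 ⟨hgt.le, hx.2⟩ (hgt.trans_le hx.2)

theorem abs_follow_sub (w : List (Fin 4)) : ∀ v v' : Lat,
    |ev (follow w v) - ev (follow w v')| = |ev v - ev v'| := by
  induction w with
  | nil => exact fun _ _ => rfl
  | cons i w ih =>
    intro v v'
    rw [follow, follow, ih, ev_latBranch, ev_latBranch]
    fin_cases i <;> simp only [branch]
    · rw [abs_sub_comm]; congr 1; ring
    · congr 1; ring
    · congr 1; ring
    · rw [abs_sub_comm]; congr 1; ring

theorem abs_seg_sub (v v' : Lat) (t t' : ℝ) :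
    |seg v v' t - seg v v' t'| = |t - t'| * |ev v - ev v'| := by
  rw [← abs_mul, abs_sub_comm]
  congr 1
  simp only [seg]; ring

theorem ev_lo_lt_ev_hi (i : Fin 4) : ev (lo i) < ev (hi i) := by
  apply ev_lt_of_latLt
  revert i; decide +kernel

/-- An iterate of an entry point in each cell. -/
def cellPoint : Fin 4 → Fin 3 × List (Fin 4)
  | 0 => (1, [])
  | 1 => (0, [])
  | 2 => (0, [1, 3, 0])
  | 3 => (2, [])

theorem exists_retOrbit_mem_cell (i : Fin 4) : ∃ z ∈ retOrbit, z ∈ cell i := by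
  have hc : itinerary (cellPoint i).2 (entry (cellPoint i).1) (entry (cellPoint i).1) = true ∧
      inCell i (follow (cellPoint i).2 (entry (cellPoint i).1))
        (follow (cellPoint i).2 (entry (cellPoint i).1)) = true := by
    revert i; decide +kernel
  have ht : (1 / 2 : ℝ) ∈ Ioo (0 : ℝ) 1 := ⟨by norm_num, by norm_num⟩
  refine ⟨_, ⟨(cellPoint i).1, (cellPoint i).2.length, rfl⟩, ?_⟩
  have := retT_iterate_seg ht _ _ _ hc.1
  rw [seg_self] at this
  rw [this]
  exact seg_mem_cell hc.2 ht

theorem ev_hi_le_one (i : Fin 4) : ev (hi i) ≤ 1 := by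
  rw [← ev_one]
  apply ev_le_of_latLe
  revert i; decide +kernel

theorem ev_lo_nonneg (i : Fin 4) : 0 ≤ ev (lo i) := by
  have : ev (0, 0, 0) = 0 := by simp [ev]
  rw [← this]
  apply ev_le_of_latLe
  revert i; decide +kernel

theorem exists_retOrbit_near (n : ℕ) : ∀ i, ∀ x ∈ Icc (ev (lo i)) (ev (hi i)),
    ∃ z ∈ retOrbit, z ∈ cell i ∧ |x - z| ≤ 1 / eta ^ n := by
  induction n with
  | zero =>
    intro i x hx
    obtain ⟨z, hz, hzi⟩ := exists_retOrbit_mem_cell i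
    refine ⟨z, hz, hzi, ?_⟩
    have := ev_hi_le_one i
    have := ev_lo_nonneg i
    rw [pow_zero, div_one, abs_le]
    constructor <;> linarith [hx.1, hx.2, hzi.1, hzi.2]
  | succ n ih =>
    intro i x hx
    -- The point lies on a floor, an isometric copy of a cell divided by η. The induction hypothesis
    -- in that cell, divided by η and moved along `w`, gains the factor 1/η.
    obtain ⟨j, w, t, ht, h1, h2, rfl⟩ := exists_floor _ _ (floorsCover_floors i) hx (ev_lo_lt_ev_hi i)
    have hlt := ev_lo_lt_ev_hi j
    have hy : seg (lo j) (hi j) t ∈ Icc (ev (lo j)) (ev (hi j)) := by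
      have := mul_nonneg ht.1 (sub_nonneg.2 hlt.le)
      have := mul_nonneg (sub_nonneg.2 ht.2) (sub_nonneg.2 hlt.le)
      constructor <;> simp only [seg] <;> linarith
    obtain ⟨z, hz, hzj, hd⟩ := ih j _ hy
    obtain ⟨t', ht', rfl⟩ := exists_seg_of_mem_Ioo hzj
    refine ⟨seg (follow w (divEta (lo j))) (follow w (divEta (hi j))) t', ?_,
      seg_mem_cell h2 ht', ?_⟩
    · rw [← retT_iterate_seg ht' w _ _ h1, seg_divEta]
      exact retT_iterate_mem_retOrbit (div_eta_mem_retOrbit hz) _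
    · rw [abs_seg_sub] at hd ⊢
      rw [abs_follow_sub, ev_divEta, ev_divEta, ← sub_div, abs_div, abs_of_pos eta_pos,
        ← mul_div_assoc, pow_succ, ← div_div]
      exact div_le_div_of_nonneg_right hd eta_pos.le

theorem exists_retOrbit_between {x y : ℝ} (hx : 0 ≤ x) (hxy : x < y) (hy : y ≤ 1) :
    ∃ z ∈ retOrbit, x < z ∧ z < y := by
  obtain ⟨n, hn⟩ := exists_pow_lt_of_lt_one (show 0 < (y - x) / 2 by linarith)
    ((div_lt_one eta_pos).2 one_lt_eta)
  rw [div_pow, one_pow] at hn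
  have hm : ∃ i, (x + y) / 2 ∈ Icc (ev (lo i)) (ev (hi i)) := by
    have hs := nu_sum
    rcases le_total ((x + y) / 2) (ev (hi 0)) with h | h
    · exact ⟨0, by simp [lo, ev]; linarith, h⟩
    rcases le_total ((x + y) / 2) (ev (hi 1)) with h' | h'
    · exact ⟨1, h, h'⟩
    rcases le_total ((x + y) / 2) (ev (hi 2)) with h'' | h''
    · exact ⟨2, h', h''⟩
    · exact ⟨3, h'', by rw [show hi 3 = (2, 1, 1) from rfl, ev_one]; linarith⟩
  obtain ⟨i, hi⟩ := hm
  obtain ⟨z, hz, -, hd⟩ := exists_retOrbit_near n i _ hi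
  rw [abs_le] at hd
  exact ⟨z, hz, by linarith, by linarith⟩

theorem mem_orbitSet (i : Fin 4) (k : ℕ) : isoT^[k] (pt i) ∈ orbitSet := ⟨i, k, rfl⟩

theorem isoT_mem_orbitSet {x : ℝ} (hx : x ∈ orbitSet) : isoT x ∈ orbitSet := by
  obtain ⟨i, k, rfl⟩ := hx
  exact ⟨i, k + 1, (Function.iterate_succ_apply' _ _ _).symm⟩

theorem retOrbit_subset_orbitSet : retOrbit ⊆ orbitSet := by
  rintro x ⟨j, m, rfl⟩
  obtain ⟨k, h, -⟩ := exists_retT_iterate_eq j m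
  rw [h]
  exact mem_orbitSet _ _

theorem exists_orbitSet_between {x y : ℝ} (hx : 0 ≤ x) (hxy : x < y) (hy : y ≤ lamNorm) :
    ∃ z ∈ orbitSet, x < z ∧ z < y := by
  have h0 := nu_pos 0
  have h1 := nu_pos 1
  have h2 := nu_pos 2
  have hs := nu_sum
  rw [lamNorm_eq] at hy
  rcases lt_or_ge x 1 with h | h
  · obtain ⟨z, hz, h1, h2⟩ := exists_retOrbit_between hx (lt_min hxy h) (min_le_right y 1)
    exact ⟨z, retOrbit_subset_orbitSet hz, h1, h2.trans_le (min_le_left _ _)⟩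
  -- Above 1 density is inherited from I₂, which T reverses isometrically onto (1, |λ|].
  have key : ∀ x' y', 1 ≤ x' → x' < y' → y' ≤ 2 * nu 0 + 2 * nu 1 + 2 * nu 2 →
      ∃ z ∈ orbitSet, x' < z ∧ z < y' := by
    intro x' y' h3 h4 h5
    obtain ⟨z, hz, hl, hr⟩ := exists_retOrbit_between
      (x := 3 * nu 0 + 2 * nu 1 + 2 * nu 2 - y') (y := 3 * nu 0 + 2 * nu 1 + 2 * nu 2 - x')
      (by linarith) (by linarith) (by linarith)
    refine ⟨isoT z, isoT_mem_orbitSet (retOrbit_subset_orbitSet hz), ?_⟩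
    rw [isoT, lam_zero, lam_one, lamNorm_eq, if_neg (by linarith), if_pos (by linarith)]
    constructor <;> linarith
  exact key x y h hxy hy

/-! ### The orbit set -/

/-- Excluding 0 matters: p₁ has no preimage, so it is met only at time 0 of its own orbit. -/
theorem isoT_mem_Ioc {x : ℝ} (hx : x ∈ Icc 0 lamNorm) : isoT x ∈ Ioc 0 lamNorm := by
  have h0 := nu_pos 0
  have h1 := nu_pos 1
  have h2 := nu_pos 2
  rw [lamNorm_eq] at hx ⊢
  obtain ⟨hl, hr⟩ := hx
  simp only [isoT, lam_zero, lam_one, lam_two, lamNorm_eq]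
  split_ifs <;> constructor <;> linarith

theorem lamNorm_pos : 0 < lamNorm := by
  have h0 := nu_pos 0
  have h1 := nu_pos 1
  have h2 := nu_pos 2
  rw [lamNorm_eq]
  linarith

theorem pt_succ_mem_Ioc (j : Fin 3) : pt j.succ ∈ Ioc 0 lamNorm := by
  have h0 := nu_pos 0
  have h1 := nu_pos 1
  have h2 := nu_pos 2
  have hs := nu_sum
  fin_cases j
  · simp only [Fin.mk_zero, Fin.succ_zero_eq_one, pt_one, lamNorm_eq]
    constructor <;> linarith
  · simp only [Fin.mk_one, Fin.succ_one_eq_two, pt_two, lamNorm_eq]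
    constructor <;> linarith
  · exact ⟨lamNorm_pos, le_rfl⟩

theorem iterate_mem_Icc (i : Fin 4) (k : ℕ) : isoT^[k] (pt i) ∈ Icc 0 lamNorm := by
  induction k with
  | zero =>
    rcases Fin.eq_zero_or_eq_succ i with rfl | ⟨j, rfl⟩
    · exact ⟨le_rfl, lamNorm_pos.le⟩
    · exact Ioc_subset_Icc_self (pt_succ_mem_Ioc j)
  | succ k ih =>
    rw [Function.iterate_succ_apply']
    exact Ioc_subset_Icc_self (isoT_mem_Ioc ih)

theorem iterate_succ_pos (i : Fin 4) (k : ℕ) : 0 < isoT^[k + 1] (pt i) := by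
  rw [Function.iterate_succ_apply']
  exact (isoT_mem_Ioc (iterate_mem_Icc i k)).1

theorem iterate_pt_succ_pos (j : Fin 3) (k : ℕ) : 0 < isoT^[k] (pt j.succ) := by
  rcases k with _ | k
  · exact (pt_succ_mem_Ioc j).1
  · exact iterate_succ_pos _ _

theorem iterate_succ_pt_zero (k : ℕ) : isoT^[k + 1] (pt 0) = isoT^[k + 1] (pt 3) := by
  rw [Function.iterate_succ_apply, Function.iterate_succ_apply, pt_zero, pt_three, isoT_zero,
    isoT_lamNorm]

theorem iterate_pt_cases (i : Fin 4) (k : ℕ) : (i = 0 ∧ k = 0) ∨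
    ∃ j : Fin 3, isoT^[k] (pt i) = isoT^[k] (pt j.succ) ∧ (i = j.succ ∨ i = 0 ∧ j = 2 ∧ 0 < k) := by
  rcases Fin.eq_zero_or_eq_succ i with rfl | ⟨j, rfl⟩
  · rcases k with _ | k
    · exact Or.inl ⟨rfl, rfl⟩
    · exact Or.inr ⟨2, iterate_succ_pt_zero k, Or.inr ⟨rfl, rfl, k.succ_pos⟩⟩
  · exact Or.inr ⟨j, rfl, Or.inl rfl⟩

/-- The only coincidences among the orbits of the points `pt i`. -/
theorem iterate_eq_iterate_iff {i j : Fin 4} {k m : ℕ} :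
    isoT^[k] (pt i) = isoT^[m] (pt j) ↔
      k = m ∧ (i = j ∨ 0 < k ∧ (i = 0 ∨ i = 3) ∧ (j = 0 ∨ j = 3)) := by
  constructor
  · intro h
    rcases iterate_pt_cases i k with ⟨rfl, rfl⟩ | ⟨i', hi, hi'⟩ <;>
    rcases iterate_pt_cases j m with ⟨rfl, rfl⟩ | ⟨j', hj, hj'⟩
    · exact ⟨rfl, Or.inl rfl⟩
    · have := iterate_pt_succ_pos j' m
      rw [← hj, ← h] at this
      exact absurd this (lt_irrefl _)
    · have := iterate_pt_succ_pos i' k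
      rw [← hi, h] at this
      exact absurd this (lt_irrefl _)
    · rw [hi, hj] at h
      obtain ⟨rfl, rfl⟩ := eq_of_iterate_eq h
      refine ⟨rfl, ?_⟩
      rcases hi' with rfl | ⟨rfl, rfl, hk⟩ <;> rcases hj' with rfl | ⟨rfl, hj', hk'⟩
      · exact Or.inl rfl
      · subst hj'
        exact Or.inr ⟨hk', Or.inr rfl, Or.inl rfl⟩
      · exact Or.inr ⟨hk, Or.inl rfl, Or.inr rfl⟩
      · exact Or.inl rfl
  · rintro ⟨rfl, rfl | ⟨hk, hi, hj⟩⟩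
    · rfl
    · obtain ⟨k, rfl⟩ := Nat.exists_eq_succ_of_ne_zero hk.ne'
      rcases hi with rfl | rfl <;> rcases hj with rfl | rfl
      · rfl
      · exact iterate_succ_pt_zero k
      · exact (iterate_succ_pt_zero k).symm
      · rfl

theorem orbitSet_countable : orbitSet.Countable := by
  have : orbitSet = range fun q : Fin 4 × ℕ => isoT^[q.2] (pt q.1) := by
    ext x
    simp [orbitSet, eq_comm]
  rw [this]
  exact countable_range _

theorem orbitSet_infinite : orbitSet.Infinite :=
  infinite_of_injective_forall_mem (f := fun k : ℕ => isoT^[k] (pt 1))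
    (fun _ _ h => (iterate_eq_iterate_iff.1 h).1) (fun k => mem_orbitSet 1 k)

theorem orbitSet_subset : orbitSet ⊆ Icc 0 lamNorm := by
  rintro x ⟨i, k, rfl⟩
  exact iterate_mem_Icc i k

theorem Icc_subset_closure_orbitSet : Icc 0 lamNorm ⊆ closure orbitSet := by
  intro x hx
  rw [Metric.mem_closure_iff]
  intro ε hε
  have hL := lamNorm_pos
  rcases lt_or_ge x lamNorm with h | h
  · obtain ⟨z, hz, h1, h2⟩ := exists_orbitSet_between hx.1
      (lt_min h (show x < x + ε by linarith)) (min_le_left _ _)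
    refine ⟨z, hz, ?_⟩
    have := h2.trans_le (min_le_right _ _)
    rw [Real.dist_eq, abs_lt]
    constructor <;> linarith
  · have hx' : x = lamNorm := le_antisymm hx.2 h
    exact ⟨x, hx' ▸ mem_orbitSet 3 0, by simpa using hε⟩

/-! ### The atomic mass carried by the orbits -/

/-- The sum of `1 / 2 ^ k` over the visit times `k` of the orbit of `pt j` to `A`. -/
noncomputable def visits (j : Fin 4) (A : Set ℝ) : ℝ :=
  ∑' k : ℕ, A.indicator (fun _ => 1 / (2 : ℝ) ^ k) (isoT^[k] (pt j))

theorem summable_one_div_two_pow : Summable fun k : ℕ => 1 / (2 : ℝ) ^ k := by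
  simpa using summable_geometric_two

theorem one_div_two_pow_nonneg (k : ℕ) : 0 ≤ 1 / (2 : ℝ) ^ k := by positivity

theorem summable_visits (j : Fin 4) (A : Set ℝ) :
    Summable fun k : ℕ => A.indicator (fun _ => 1 / (2 : ℝ) ^ k) (isoT^[k] (pt j)) :=
  summable_one_div_two_pow.of_nonneg_of_le
    (fun k => indicator_nonneg (fun _ _ => one_div_two_pow_nonneg k) _)
    (fun k => indicator_le_self' (fun _ _ => one_div_two_pow_nonneg k) _)

theorem visits_mono (j : Fin 4) {A B : Set ℝ} (h : ∀ x ∈ Icc 0 lamNorm, x ∈ A → x ∈ B) :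
    visits j A ≤ visits j B := by
  refine (summable_visits j A).tsum_le_tsum (fun k => ?_) (summable_visits j B)
  by_cases hA : isoT^[k] (pt j) ∈ A
  · rw [indicator_of_mem hA, indicator_of_mem (h _ (iterate_mem_Icc j k) hA)]
  · rw [indicator_of_notMem hA]
    exact indicator_nonneg (fun _ _ => one_div_two_pow_nonneg k) _

theorem visits_union (j : Fin 4) {A B : Set ℝ} (h : Disjoint A B) :
    visits j (A ∪ B) = visits j A + visits j B := by
  rw [visits, visits, visits, ← (summable_visits j A).tsum_add (summable_visits j B)]
  refine tsum_congr fun k => ?_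
  rw [indicator_union_of_disjoint h]

theorem visits_of_subset (j : Fin 4) {A : Set ℝ} (h : Icc 0 lamNorm ⊆ A) : visits j A = 2 := by
  have : visits j A = ∑' k : ℕ, (1 / 2 : ℝ) ^ k := by
    refine tsum_congr fun k => ?_
    rw [indicator_of_mem (h (iterate_mem_Icc j k)), one_div_pow]
  rw [this, tsum_geometric_two]

theorem one_div_le_visits {j : Fin 4} {k : ℕ} {A : Set ℝ} (h : isoT^[k] (pt j) ∈ A) :
    1 / (2 : ℝ) ^ k ≤ visits j A := by
  have := (summable_visits j A).le_tsum k fun m _ =>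
    indicator_nonneg (fun _ _ => one_div_two_pow_nonneg m) _
  rwa [indicator_of_mem h] at this

theorem visits_nonneg (j : Fin 4) (A : Set ℝ) : 0 ≤ visits j A :=
  tsum_nonneg fun k => indicator_nonneg (fun _ _ => one_div_two_pow_nonneg k) _

theorem visits_eq_add (j : Fin 4) (A : Set ℝ) :
    visits j A = A.indicator 1 (pt j) + 1 / 2 * visits j (isoT ⁻¹' A) := by
  rw [visits, (summable_visits j A).tsum_eq_zero_add, visits, ← tsum_mul_left]
  congr 1
  · by_cases h : pt j ∈ A <;> simp [h]
  · refine tsum_congr fun k => ?_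
    rw [Function.iterate_succ_apply']
    by_cases h : isoT (isoT^[k] (pt j)) ∈ A
    · rw [indicator_of_mem h, indicator_of_mem (show _ ∈ isoT ⁻¹' A from h), pow_succ]
      field_simp
    · rw [indicator_of_notMem h, indicator_of_notMem (show _ ∉ isoT ⁻¹' A from h), mul_zero]

theorem visits_singleton (i j : Fin 4) (k : ℕ) : visits j {isoT^[k] (pt i)} =
    if i = j ∨ 0 < k ∧ (i = 0 ∨ i = 3) ∧ (j = 0 ∨ j = 3) then 1 / (2 : ℝ) ^ k else 0 := by
  have key (m : ℕ) : isoT^[m] (pt j) ∈ ({isoT^[k] (pt i)} : Set ℝ) ↔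
      k = m ∧ (i = j ∨ 0 < k ∧ (i = 0 ∨ i = 3) ∧ (j = 0 ∨ j = 3)) := by
    rw [mem_singleton_iff, eq_comm, iterate_eq_iterate_iff]
  rw [visits, tsum_eq_single k fun m hm => indicator_of_notMem
    (fun h => hm ((key m).1 h).1.symm) _]
  simp only [indicator_apply, key, true_and]

theorem coeffC_eq_visits (i j : Fin 4) : coeffC i j = visits j (intervalI i) := by
  rw [coeffC, tsum_subtype (setK i j) fun k : ℕ => 1 / (2 : ℝ) ^ k]
  refine tsum_congr fun k => ?_
  by_cases h : isoT^[k] (pt j) ∈ intervalI i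
  · rw [indicator_of_mem h, indicator_of_mem (show k ∈ setK i j from h)]
  · rw [indicator_of_notMem h, indicator_of_notMem (show k ∉ setK i j from h)]

/-- Dominated convergence against 2^(-k); it supplies the one-sided limits of the distribution
function. -/
theorem tendsto_visits {α : Type*} {f : Filter α} (j : Fin 4) {A : α → Set ℝ} {B : Set ℝ}
    (h : ∀ x, ∀ᶠ a in f, x ∈ A a ↔ x ∈ B) : Tendsto (fun a => visits j (A a)) f (𝓝 (visits j B)) := by
  refine tendsto_tsum_of_dominated_convergence summable_one_div_two_pow (fun k => ?_)
    (Eventually.of_forall fun a k => ?_)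
  · refine tendsto_const_nhds.congr' ?_
    filter_upwards [h (isoT^[k] (pt j))] with a ha
    by_cases hB : isoT^[k] (pt j) ∈ B
    · simp only [indicator_of_mem hB, indicator_of_mem (ha.2 hB)]
    · simp only [indicator_of_notMem hB, indicator_of_notMem fun h => hB (ha.1 h)]
  · refine (norm_indicator_le_norm_self _ _).trans (le_of_eq ?_)
    rw [Real.norm_of_nonneg (one_div_two_pow_nonneg k)]

/-- The total size of the gaps inserted at the points of `A`. -/
noncomputable def mass (l : Fin 4 → ℝ) (A : Set ℝ) : ℝ := ∑ j, l j * visits j A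

section mass

variable {l : Fin 4 → ℝ}

theorem mass_mono (hl : ∀ i, 0 < l i) {A B : Set ℝ} (h : ∀ x ∈ Icc 0 lamNorm, x ∈ A → x ∈ B) :
    mass l A ≤ mass l B :=
  Finset.sum_le_sum fun j _ => mul_le_mul_of_nonneg_left (visits_mono j h) (hl j).le

theorem mass_union {A B : Set ℝ} (h : Disjoint A B) : mass l (A ∪ B) = mass l A + mass l B := by
  simp only [mass, visits_union _ h, mul_add, Finset.sum_add_distrib]

theorem mass_of_subset (hl_sum : ∑ i, l i = 1 / 2) {A : Set ℝ} (h : Icc 0 lamNorm ⊆ A) :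
    mass l A = 1 := by
  simp only [mass, visits_of_subset _ h, ← Finset.sum_mul, hl_sum]
  norm_num

theorem mass_pos (hl : ∀ i, 0 < l i) {A : Set ℝ} {x : ℝ} (hx : x ∈ orbitSet) (h : x ∈ A) :
    0 < mass l A := by
  obtain ⟨i, k, rfl⟩ := hx
  refine Finset.sum_pos' (fun j _ => mul_nonneg (hl j).le (visits_nonneg j A))
    ⟨i, Finset.mem_univ _, mul_pos (hl i) (lt_of_lt_of_le (by positivity) (one_div_le_visits h))⟩

theorem mass_nonneg (hl : ∀ i, 0 < l i) (A : Set ℝ) : 0 ≤ mass l A :=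
  Finset.sum_nonneg fun j _ => mul_nonneg (hl j).le (visits_nonneg j A)

theorem mass_empty : mass l ∅ = 0 := by
  simp [mass, visits]

/-- The factor ½ becomes the slope of g in absolute value, and the point masses at the p_j become
the terms ℓ_j in its constants. -/
theorem mass_eq_add (A : Set ℝ) :
    mass l A = ∑ j, l j * A.indicator 1 (pt j) + 1 / 2 * mass l (isoT ⁻¹' A) := by
  simp only [mass]
  rw [Finset.mul_sum, ← Finset.sum_add_distrib]
  refine Finset.sum_congr rfl fun j _ => ?_
  rw [visits_eq_add]
  ring

theorem mass_singleton (i : Fin 4) (k : ℕ) : mass l {isoT^[k] (pt i)} = gapLength l i k := by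
  simp only [mass, visits_singleton, Fin.sum_univ_four, gapLength]
  rcases k with _ | k
  · fin_cases i <;> simp
  · fin_cases i <;> simp <;> ring

theorem mass_singleton_of_notMem {y : ℝ} (h : y ∉ orbitSet) : mass l {y} = 0 := by
  have key (j : Fin 4) (k : ℕ) : isoT^[k] (pt j) ∉ ({y} : Set ℝ) :=
    fun hk => h ⟨j, k, (mem_singleton_iff.1 hk).symm⟩
  simp [mass, visits, key]

theorem tendsto_mass {α : Type*} {f : Filter α} {A : α → Set ℝ} {B : Set ℝ}
    (h : ∀ x, ∀ᶠ a in f, x ∈ A a ↔ x ∈ B) : Tendsto (fun a => mass l (A a)) f (𝓝 (mass l B)) :=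
  tendsto_finsetSum _ fun j _ => (tendsto_visits j h).const_mul _

/-! ### The distribution function -/

theorem mass_Iic (y : ℝ) : mass l (Iic y) = mass l (Iio y) + mass l {y} := by
  rw [← Iio_union_right, mass_union (by simp)]

theorem mass_Ico {x y : ℝ} (h : x ≤ y) : mass l (Ico x y) = mass l (Iio y) - mass l (Iio x) := by
  rw [← Iio_union_Ico_eq_Iio h, mass_union (Iio_disjoint_Ici le_rfl |>.mono_right Ico_subset_Ici_self)]
  ring

theorem mass_Ioo {x y : ℝ} (h : x < y) : mass l (Ioo x y) = mass l (Iio y) - mass l (Iic x) := by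
  rw [← Iic_union_Ioo_eq_Iio h, mass_union (Iic_disjoint_Ioi le_rfl |>.mono_right Ioo_subset_Ioi_self)]
  ring

theorem mass_Ici (hl_sum : ∑ i, l i = 1 / 2) (y : ℝ) : mass l (Ici y) = 1 - mass l (Iio y) := by
  rw [← mass_of_subset hl_sum (subset_univ _), ← Iio_union_Ici, mass_union (Iio_disjoint_Ici le_rfl)]
  ring

theorem mass_Ioi (hl_sum : ∑ i, l i = 1 / 2) (y : ℝ) : mass l (Ioi y) = 1 - mass l (Iic y) := by
  rw [← mass_of_subset hl_sum (subset_univ _), ← Iic_union_Ioi, mass_union (Iic_disjoint_Ioi le_rfl)]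
  ring

theorem mass_Iic_lt_mass_Iio (hl : ∀ i, 0 < l i) {x y : ℝ} (hx : 0 ≤ x) (hxy : x < y)
    (hy : y ≤ lamNorm) : mass l (Iic x) < mass l (Iio y) := by
  obtain ⟨z, hz, hz'⟩ := exists_orbitSet_between hx hxy hy
  have := mass_pos hl (A := Ioo x y) hz hz'
  rw [mass_Ioo hxy] at this
  linarith

theorem mass_Iio_le_mass_Iic (hl : ∀ i, 0 < l i) (x : ℝ) : mass l (Iio x) ≤ mass l (Iic x) :=
  mass_mono hl fun _ _ h => Iio_subset_Iic_self h

/-- The distribution function misses values only at its jumps, and the closed fibres fill these. At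
the supremum, left continuity of μ(-∞,y) gives the lower bound and its right limit μ(-∞,y] gives the
upper one. -/
theorem exists_mem_fiber (hl : ∀ i, 0 < l i) (hl_sum : ∑ i, l i = 1 / 2) {x : ℝ}
    (hx : x ∈ Icc (0 : ℝ) 1) :
    ∃ y ∈ Icc 0 lamNorm, x ∈ Icc (mass l (Iio y)) (mass l (Iic y)) := by
  set s : Set ℝ := {y ∈ Icc 0 lamNorm | mass l (Iio y) ≤ x} with hs
  have h0 : (0 : ℝ) ∈ s := by
    refine ⟨⟨le_rfl, lamNorm_pos.le⟩, ?_⟩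
    have : mass l (Iio 0) ≤ mass l ∅ := mass_mono hl fun y hy h => absurd hy.1 (not_le.2 h)
    rw [mass_empty] at this
    exact this.trans hx.1
  have hb : BddAbove s := ⟨lamNorm, fun y hy => hy.1.2⟩
  have hmem : sSup s ∈ Icc 0 lamNorm := ⟨le_csSup hb h0, csSup_le ⟨0, h0⟩ fun y hy => hy.1.2⟩
  refine ⟨sSup s, hmem, ?_, ?_⟩
  · have ht : Tendsto (fun y => mass l (Iio y)) (𝓝[<] (sSup s)) (𝓝 (mass l (Iio (sSup s)))) := by
      refine tendsto_mass fun z => ?_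
      rcases lt_or_ge z (sSup s) with h | h
      · filter_upwards [Ioo_mem_nhdsLT h] with y hy
        exact ⟨fun _ => h, fun _ => hy.1⟩
      · filter_upwards [self_mem_nhdsWithin] with y hy
        exact ⟨fun h' => absurd (h'.trans hy) h.not_gt, fun h' => absurd h' h.not_gt⟩
    refine le_of_tendsto ht ?_
    filter_upwards [self_mem_nhdsWithin] with y hy
    obtain ⟨y', hy', hlt⟩ := exists_lt_of_lt_csSup ⟨0, h0⟩ hy
    exact (mass_mono hl fun z _ hz => lt_trans hz hlt).trans hy'.2
  · rcases hmem.2.eq_or_lt with h | h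
    · rw [h, mass_of_subset (A := Iic lamNorm) hl_sum fun y hy => hy.2]
      exact hx.2
    · have ht : Tendsto (fun y => mass l (Iio y)) (𝓝[>] (sSup s)) (𝓝 (mass l (Iic (sSup s)))) := by
        refine tendsto_mass fun z => ?_
        rcases lt_or_ge (sSup s) z with h | h
        · filter_upwards [Ioo_mem_nhdsGT h] with y hy
          exact ⟨fun h' => absurd (hy.2.trans h') (lt_irrefl _), fun h' => absurd h' h.not_ge⟩
        · filter_upwards [self_mem_nhdsWithin] with y hy
          exact ⟨fun _ => h, fun _ => lt_of_le_of_lt h hy⟩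
      refine ge_of_tendsto ht ?_
      filter_upwards [Ioo_mem_nhdsGT h] with y hy
      by_contra hc
      exact absurd (le_csSup hb ⟨⟨hmem.1.trans hy.1.le, hy.2.le⟩, (not_le.1 hc).le⟩) hy.1.not_ge

end mass

/-! ### The semiconjugacy -/

section semiconjugacy

variable {u l : Fin 4 → ℝ}

/-- The collapsing map: the fibre of `y` is the interval from `mass l (Iio y)` to
`mass l (Iic y)`. -/
noncomputable def collapse (l : Fin 4 → ℝ) (x : ℝ) : ℝ :=
  sSup {y ∈ Icc 0 lamNorm | mass l (Iio y) ≤ x}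

/-- Density puts positive mass strictly between two base points, so the fibres are disjoint and
ordered like their base points. -/
theorem le_of_mem_fibers (hl : ∀ i, 0 < l i) {x x' y y' : ℝ} (hy : y ∈ Icc 0 lamNorm)
    (hy' : y' ∈ Icc 0 lamNorm) (h : mass l (Iio y) ≤ x) (hx : x ≤ x') (h' : x' ≤ mass l (Iic y')) :
    y ≤ y' := by
  by_contra hc
  have := mass_Iic_lt_mass_Iio hl hy'.1 (not_le.1 hc) hy.2
  linarith

theorem collapse_eq_iff (hl : ∀ i, 0 < l i) (hl_sum : ∑ i, l i = 1 / 2) {x y : ℝ}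
    (hx : x ∈ Icc (0 : ℝ) 1) (hy : y ∈ Icc 0 lamNorm) :
    collapse l x = y ↔ x ∈ Icc (mass l (Iio y)) (mass l (Iic y)) := by
  have key {z : ℝ} (hz : z ∈ Icc 0 lamNorm) (h : x ∈ Icc (mass l (Iio z)) (mass l (Iic z))) :
      collapse l x = z :=
    IsGreatest.csSup_eq ⟨⟨hz, h.1⟩, fun z' hz' => le_of_mem_fibers hl hz'.1 hz hz'.2 le_rfl h.2⟩
  refine ⟨fun h => ?_, key hy⟩
  obtain ⟨z, hz, hxz⟩ := exists_mem_fiber hl hl_sum hx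
  rwa [← h, key hz hxz]

theorem collapse_mem (hl : ∀ i, 0 < l i) (hl_sum : ∑ i, l i = 1 / 2) {x : ℝ}
    (hx : x ∈ Icc (0 : ℝ) 1) : collapse l x ∈ Icc 0 lamNorm ∧
      x ∈ Icc (mass l (Iio (collapse l x))) (mass l (Iic (collapse l x))) := by
  obtain ⟨z, hz, hxz⟩ := exists_mem_fiber hl hl_sum hx
  rw [(collapse_eq_iff hl hl_sum hx hz).2 hxz]
  exact ⟨hz, hxz⟩

theorem mass_le_one (hl : ∀ i, 0 < l i) (hl_sum : ∑ i, l i = 1 / 2) (A : Set ℝ) :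
    mass l A ≤ 1 := by
  rw [← mass_of_subset hl_sum (subset_univ (Icc 0 lamNorm))]
  exact mass_mono hl fun _ _ _ => mem_univ _

theorem fiber_eq (hl : ∀ i, 0 < l i) (hl_sum : ∑ i, l i = 1 / 2) {y : ℝ}
    (hy : y ∈ Icc 0 lamNorm) :
    {x ∈ Icc (0 : ℝ) 1 | collapse l x = y} = Icc (mass l (Iio y)) (mass l (Iic y)) := by
  ext x
  constructor
  · rintro ⟨hx, h⟩
    exact (collapse_eq_iff hl hl_sum hx hy).1 h
  · intro h
    have hx : x ∈ Icc (0 : ℝ) 1 :=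
      ⟨(mass_nonneg hl _).trans h.1, h.2.trans (mass_le_one hl hl_sum _)⟩
    exact ⟨hx, (collapse_eq_iff hl hl_sum hx hy).2 h⟩

theorem monotoneOn_collapse (hl : ∀ i, 0 < l i) (hl_sum : ∑ i, l i = 1 / 2) :
    MonotoneOn (collapse l) (Icc 0 1) := fun _ hx _ hx' h =>
  le_of_mem_fibers hl (collapse_mem hl hl_sum hx).1 (collapse_mem hl hl_sum hx').1
    (collapse_mem hl hl_sum hx).2.1 h (collapse_mem hl hl_sum hx').2.2

theorem image_collapse (hl : ∀ i, 0 < l i) (hl_sum : ∑ i, l i = 1 / 2) :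
    collapse l '' Icc 0 1 = Icc 0 lamNorm := by
  ext y
  constructor
  · rintro ⟨x, hx, rfl⟩
    exact (collapse_mem hl hl_sum hx).1
  · intro hy
    have h : mass l (Iio y) ∈ {x ∈ Icc (0 : ℝ) 1 | collapse l x = y} := by
      rw [fiber_eq hl hl_sum hy]
      exact ⟨le_rfl, mass_Iio_le_mass_Iic hl y⟩
    exact ⟨_, h.1, h.2⟩

theorem continuousOn_collapse (hl : ∀ i, 0 < l i) (hl_sum : ∑ i, l i = 1 / 2) :
    ContinuousOn (collapse l) (Icc 0 1) := by
  let f : Icc (0 : ℝ) 1 → Icc 0 lamNorm := fun x => ⟨collapse l x, (collapse_mem hl hl_sum x.2).1⟩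
  have hm : Monotone f := fun x y h => monotoneOn_collapse hl hl_sum x.2 y.2 h
  have hs : Function.Surjective f := by
    rintro ⟨y, hy⟩
    rw [← image_collapse hl hl_sum] at hy
    obtain ⟨x, hx, rfl⟩ := hy
    exact ⟨⟨x, hx⟩, rfl⟩
  rw [continuousOn_iff_continuous_domRestrict]
  -- A monotone surjection has no jumps.
  exact continuous_subtype_val.comp (hm.continuous_of_surjective hs)

theorem mapsTo_isoT : MapsTo isoT (Icc 0 lamNorm) (Icc 0 lamNorm) :=
  fun _ hx => Ioc_subset_Icc_self (isoT_mem_Ioc hx)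

theorem mapsTo_mapG (hu : ∀ i, 0 < u i) (hl : ∀ i, 0 < l i) (hu_sum : ∑ i, u i = 1)
    (hl_sum : ∑ i, l i = 1 / 2) : MapsTo (mapG u l) (Icc 0 1) (Icc 0 1) := by
  rintro x ⟨hx0, hx1⟩
  rw [Fin.sum_univ_four] at hu_sum hl_sum
  have := hu 0
  have := hu 1
  have := hu 2
  have := hu 3
  have := hl 0
  have := hl 1
  have := hl 2
  have := hl 3
  unfold mapG
  split_ifs <;> constructor <;> linarith

/-- The weights `u i` are the masses of the intervals `I i`. -/
theorem eq_mass_intervalI (hl_sum : ∑ i, l i = 1 / 2)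
    (hul : (fun i : Fin 3 => u i.castSucc) =
      matM.mulVec (fun j : Fin 3 => l j.castSucc) +
        (1 / 2 : ℝ) • (fun i : Fin 3 => coeffC i.castSucc 3)) (i : Fin 3) :
    u i.castSucc = mass l (intervalI i.castSucc) := by
  have h := congrFun hul i
  rw [Fin.sum_univ_four] at hl_sum
  simp only [Pi.add_apply, Pi.smul_apply, smul_eq_mul, Matrix.mulVec, dotProduct, matM,
    Matrix.of_apply, Fin.sum_univ_three, coeffC_eq_visits] at h
  rw [h, mass, Fin.sum_univ_four]
  simp only [Fin.castSucc_zero, Fin.castSucc_one, show Fin.castSucc (2 : Fin 3) = (2 : Fin 4) from rfl]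
  -- Replacing ½ by ∑ ℓ_j turns the differences c_ij - c_i4 back into c_ij.
  linear_combination (-visits 3 (intervalI i.castSucc)) * hl_sum

theorem mass_Iio_zero (hl : ∀ i, 0 < l i) : mass l (Iio 0) = 0 := by
  have : mass l (Iio 0) ≤ mass l ∅ := mass_mono hl fun y hy h => absurd hy.1 (not_le.2 h)
  rw [mass_empty] at this
  exact le_antisymm this (mass_nonneg hl _)

/-- The sum of the entries of `l` at the points `pt j` that lie in `A`. -/
theorem sum_indicator_pt (A : Set ℝ) : ∑ j, l j * A.indicator 1 (pt j) =
    l 0 * A.indicator 1 (0 : ℝ) + l 1 * A.indicator 1 (nu 0 + nu 2) + l 2 * A.indicator 1 (1 : ℝ) +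
      l 3 * A.indicator 1 lamNorm := by
  rw [Fin.sum_univ_four, pt_zero, pt_one, pt_two, pt_three]

theorem indicator_one_mem_Icc (A : Set ℝ) (x : ℝ) : A.indicator (1 : ℝ → ℝ) x ∈ Icc (0 : ℝ) 1 := by
  by_cases h : x ∈ A <;> simp [h]

/-- The images lie in the order T(I₃), T(I₁), T(I₄), T(I₂), with p₂ between the first two and p₃
between the last two. On each branch, the constant in g collects half the mass of the intervals sent
below the current image, together with the ℓ_j at the points p_j below it. -/
theorem mapG_mem_fiber (hl : ∀ i, 0 < l i) (hl_sum : ∑ i, l i = 1 / 2)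
    (h0 : mass l (Iio (lam 0)) = u 0) (h1 : mass l (Iio (lam 0 + lam 1)) = u 0 + u 1)
    (h2 : mass l (Iio (lam 0 + lam 1 + lam 2)) = u 0 + u 1 + u 2) {x y : ℝ}
    (hy : y ∈ Icc 0 lamNorm) (hx : x ∈ Icc (mass l (Iio y)) (mass l (Iic y))) :
    mapG u l x ∈ Icc (mass l (Iio (isoT y))) (mass l (Iic (isoT y))) := by
  have n0 := nu_pos 0
  have n1 := nu_pos 1
  have n2 := nu_pos 2
  have ns := nu_sum
  have l0 := hl 0
  have l1 := hl 1
  have l2 := hl 2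
  have l3 := hl 3
  obtain ⟨hx1, hx2⟩ := hx
  have lt_of {b : ℝ} (hyb : y < b) (hb : b ≤ lamNorm) : x < mass l (Iio b) :=
    hx2.trans_lt (mass_Iic_lt_mass_Iio hl hy.1 hyb hb)
  have le_of {b : ℝ} (hyb : b ≤ y) : mass l (Iio b) ≤ x :=
    (mass_mono hl fun z _ hz => lt_of_lt_of_le hz hyb).trans hx1
  -- One inclusion is enough for each bound, so preimages need not be computed exactly at endpoints
  -- of branches, where images may meet.
  have lower {A : Set ℝ} (h : ∀ z ∈ Icc 0 lamNorm, z ∈ A → isoT z ≤ isoT y) :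
      mass l A ≤ mass l (isoT ⁻¹' Iic (isoT y)) := mass_mono hl h
  have upper {A : Set ℝ} (h : ∀ z ∈ Icc 0 lamNorm, isoT z < isoT y → z ∈ A) :
      mass l (isoT ⁻¹' Iio (isoT y)) ≤ mass l A := mass_mono hl h
  have hI3 : mass l (Ico (lam 0 + lam 1) (lam 0 + lam 1 + lam 2)) = u 2 := by
    rw [mass_Ico (by rw [lam_two]; linarith), h1, h2]
    ring
  have ind (A : Set ℝ) {c : ℝ} (hc : 0 < c) (z : ℝ) :
      0 ≤ c * A.indicator (1 : ℝ → ℝ) z ∧ c * A.indicator (1 : ℝ → ℝ) z ≤ c :=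
    ⟨mul_nonneg hc.le (indicator_one_mem_Icc A z).1,
      mul_le_of_le_one_right hc.le (indicator_one_mem_Icc A z).2⟩
  have hin {A : Set ℝ} {z : ℝ} (h : z ∈ A) : A.indicator (1 : ℝ → ℝ) z = 1 := by simp [h]
  have hout {A : Set ℝ} {z : ℝ} (h : z ∉ A) : A.indicator (1 : ℝ → ℝ) z = 0 := by simp [h]
  obtain ⟨hy0, hyL⟩ := hy
  rw [mem_Icc, mass_eq_add (Iio (isoT y)), mass_eq_add (Iic (isoT y)), sum_indicator_pt,
    sum_indicator_pt]
  have hL := lamNorm_eq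
  have e0 := lam_zero
  have e1 := lam_one
  have e2 := lam_two
  have i0 := ind (Iio (isoT y)) l0 0
  have i1 := ind (Iio (isoT y)) l1 (nu 0 + nu 2)
  have i2 := ind (Iio (isoT y)) l2 1
  have i3 := ind (Iio (isoT y)) l3 lamNorm
  have j0 := ind (Iic (isoT y)) l0 0
  have j1 := ind (Iic (isoT y)) l1 (nu 0 + nu 2)
  have j2 := ind (Iic (isoT y)) l2 1
  have j3 := ind (Iic (isoT y)) l3 lamNorm
  rcases lt_or_ge y (lam 0) with c0 | c0
  · have hT : isoT y = -y + lam 0 + lam 2 := by rw [isoT, if_pos c0]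
    have b0 := lt_of c0 (by linarith)
    have lw := lower (A := Ico (lam 0 + lam 1) (lam 0 + lam 1 + lam 2) ∪ Ico y (lam 0)) (by
      rintro z ⟨hz0, hzL⟩ (⟨hz1, hz2⟩ | ⟨hz1, hz2⟩) <;> rw [hT] <;> simp only [isoT] <;>
        split_ifs <;> linarith)
    have up := upper (A := Ico (lam 0 + lam 1) (lam 0 + lam 1 + lam 2) ∪ Ioo y (lam 0)) (by
      rintro z ⟨hz0, hzL⟩ hz
      rw [hT] at hz
      simp only [isoT] at hz
      simp only [mem_union, mem_Ico, mem_Ioo]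
      split_ifs at hz
      · exact Or.inr ⟨by linarith, by linarith⟩
      · linarith
      · exact Or.inl ⟨by linarith, by linarith⟩
      · linarith)
    rw [mass_union (by
      rw [Set.disjoint_left]; rintro z ⟨hz1, hz2⟩ ⟨hz3, hz4⟩; linarith), hI3,
      mass_Ico c0.le, h0] at lw
    rw [mass_union (by
      rw [Set.disjoint_left]; rintro z ⟨hz1, hz2⟩ ⟨hz3, hz4⟩; linarith), hI3,
      mass_Ioo c0, h0] at up
    rw [h0] at b0
    -- On this branch p₁ and p₂ lie below T(y) while p₃ and p₄ lie above, hence the summand ℓ₁ + ℓ₂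
    -- in g.
    rw [mapG, if_pos b0, hin (A := Iic (isoT y)) (z := 0) (by rw [mem_Iic]; linarith),
      hin (A := Iic (isoT y)) (z := nu 0 + nu 2) (by rw [mem_Iic]; linarith),
      hout (A := Iio (isoT y)) (z := 1) (by rw [mem_Iio]; linarith),
      hout (A := Iio (isoT y)) (z := lamNorm) (by rw [mem_Iio]; linarith)]
    constructor <;> linarith
  have b0 := le_of c0
  rw [h0] at b0
  rcases lt_or_ge y (lam 0 + lam 1) with c1 | c1
  · have hT : isoT y = -y + lam 0 + lamNorm := by rw [isoT, if_neg c0.not_gt, if_pos c1]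
    have b1 := lt_of c1 (by linarith)
    have lw := lower (A := Iio (lam 0) ∪ Ici y) (by
      rintro z ⟨hz0, hzL⟩ (hz | hz) <;> simp only [mem_Iio, mem_Ici] at hz <;> rw [hT] <;>
        simp only [isoT] <;> split_ifs <;> linarith)
    have up := upper (A := Iio (lam 0) ∪ Ioi y) (by
      rintro z ⟨hz0, hzL⟩ hz
      rw [hT] at hz
      simp only [isoT] at hz
      simp only [mem_union, mem_Iio, mem_Ioi]
      split_ifs at hz
      · exact Or.inl (by linarith)
      · exact Or.inr (by linarith)
      · exact Or.inr (by linarith)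
      · exact Or.inr (by linarith))
    rw [mass_union (Iio_disjoint_Ici c0), mass_Ici hl_sum, h0] at lw
    rw [mass_union (by
      rw [Set.disjoint_left]; intro z hz hz'; simp only [mem_Iio, mem_Ioi] at hz hz'; linarith),
      mass_Ioi hl_sum, h0] at up
    rw [h1] at b1
    rw [mapG, if_neg b0.not_gt, if_pos b1,
      hin (A := Iic (isoT y)) (z := 0) (by rw [mem_Iic]; linarith),
      hin (A := Iic (isoT y)) (z := nu 0 + nu 2) (by rw [mem_Iic]; linarith),
      hin (A := Iic (isoT y)) (z := 1) (by rw [mem_Iic]; linarith),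
      hout (A := Iio (isoT y)) (z := lamNorm) (by rw [mem_Iio]; linarith)]
    constructor <;> linarith
  have b1 := le_of c1
  rw [h1] at b1
  rcases lt_or_ge y (lam 0 + lam 1 + lam 2) with c2 | c2
  · have hT : isoT y = -y + lam 0 + lam 1 + lam 2 := by
      rw [isoT, if_neg c0.not_gt, if_neg c1.not_gt, if_pos c2]
    have b2 := lt_of c2 (by linarith)
    have lw := lower (A := Ico y (lam 0 + lam 1 + lam 2)) (by
      rintro z ⟨hz0, hzL⟩ ⟨hz1, hz2⟩
      rw [hT]
      simp only [isoT]
      split_ifs <;> linarith)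
    have up := upper (A := Ioo y (lam 0 + lam 1 + lam 2)) (by
      rintro z ⟨hz0, hzL⟩ hz
      rw [hT] at hz
      simp only [isoT] at hz
      split_ifs at hz
      · linarith
      · linarith
      · exact ⟨by linarith, by linarith⟩
      · linarith)
    rw [mass_Ico c2.le, h2] at lw
    rw [mass_Ioo c2, h2] at up
    rw [h2] at b2
    rw [mapG, if_neg b0.not_gt, if_neg b1.not_gt, if_pos b2,
      hin (A := Iic (isoT y)) (z := 0) (by rw [mem_Iic]; linarith),
      hout (A := Iio (isoT y)) (z := nu 0 + nu 2) (by rw [mem_Iio]; linarith),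
      hout (A := Iio (isoT y)) (z := 1) (by rw [mem_Iio]; linarith),
      hout (A := Iio (isoT y)) (z := lamNorm) (by rw [mem_Iio]; linarith)]
    constructor <;> linarith
  · have b2 := le_of c2
    rw [h2] at b2
    have hT : isoT y = -y + lam 0 + lam 2 + lamNorm := by
      rw [isoT, if_neg c0.not_gt, if_neg c1.not_gt, if_neg c2.not_gt]
    have lw := lower
      (A := (Iio (lam 0) ∪ Ico (lam 0 + lam 1) (lam 0 + lam 1 + lam 2)) ∪ Ici y) (by
      rintro z ⟨hz0, hzL⟩ ((hz | ⟨hz, hz'⟩) | hz) <;>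
        try simp only [mem_Iio, mem_Ici] at hz
      all_goals
        rw [hT]
        simp only [isoT]
        split_ifs <;> linarith)
    have up := upper
      (A := (Iio (lam 0) ∪ Ico (lam 0 + lam 1) (lam 0 + lam 1 + lam 2)) ∪ Ioi y) (by
      rintro z ⟨hz0, hzL⟩ hz
      rw [hT] at hz
      simp only [isoT] at hz
      simp only [mem_union, mem_Iio, mem_Ioi, mem_Ico]
      split_ifs at hz
      · exact Or.inl (Or.inl (by linarith))
      · linarith
      · exact Or.inl (Or.inr ⟨by linarith, by linarith⟩)
      · exact Or.inr (by linarith))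
    have hd : Disjoint (Iio (lam 0)) (Ico (lam 0 + lam 1) (lam 0 + lam 1 + lam 2)) := by
      rw [Set.disjoint_left]; rintro z hz ⟨hz1, hz2⟩; rw [mem_Iio] at hz; linarith
    rw [mass_union (by
      rw [Set.disjoint_left]; rintro z (hz | ⟨hz1, hz2⟩) hz' <;>
        simp only [mem_Iio, mem_Ici] at * <;> linarith), mass_union hd, hI3,
      mass_Ici hl_sum, h0] at lw
    rw [mass_union (by
      rw [Set.disjoint_left]; rintro z (hz | ⟨hz1, hz2⟩) hz' <;>
        simp only [mem_Iio, mem_Ioi] at * <;> linarith), mass_union hd, hI3,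
      mass_Ioi hl_sum, h0] at up
    rw [mapG, if_neg b0.not_gt, if_neg b1.not_gt, if_neg b2.not_gt,
      hin (A := Iic (isoT y)) (z := 0) (by rw [mem_Iic]; linarith),
      hin (A := Iic (isoT y)) (z := nu 0 + nu 2) (by rw [mem_Iic]; linarith),
      hout (A := Iio (isoT y)) (z := 1) (by rw [mem_Iio]; linarith),
      hout (A := Iio (isoT y)) (z := lamNorm) (by rw [mem_Iio]; linarith)]
    constructor <;> linarith

theorem isSemiconjugacy_collapse (hu : ∀ i, 0 < u i) (hl : ∀ i, 0 < l i)
    (hu_sum : ∑ i, u i = 1) (hl_sum : ∑ i, l i = 1 / 2)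
    (hul : (fun i : Fin 3 => u i.castSucc) =
      matM.mulVec (fun j : Fin 3 => l j.castSucc) +
        (1 / 2 : ℝ) • (fun i : Fin 3 => coeffC i.castSucc 3)) :
    IsSemiconjugacy lamNorm (mapG u l) isoT (collapse l) := by
  refine ⟨mapsTo_mapG hu hl hu_sum hl_sum, mapsTo_isoT, continuousOn_collapse hl hl_sum,
    monotoneOn_collapse hl hl_sum, image_collapse hl hl_sum, fun x hx => ?_⟩
  have n0 := nu_pos 0
  have n1 := nu_pos 1
  have n2 := nu_pos 2
  have k0 : u 0 = mass l (Ico 0 (lam 0)) := eq_mass_intervalI hl_sum hul 0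
  have k1 : u 1 = mass l (Ico (lam 0) (lam 0 + lam 1)) := eq_mass_intervalI hl_sum hul 1
  have k2 : u 2 = mass l (Ico (lam 0 + lam 1) (lam 0 + lam 1 + lam 2)) :=
    eq_mass_intervalI hl_sum hul 2
  rw [mass_Ico (by rw [lam_zero]; linarith), mass_Iio_zero hl] at k0
  rw [mass_Ico (by rw [lam_one]; linarith)] at k1
  rw [mass_Ico (by rw [lam_two]; linarith)] at k2
  obtain ⟨hy, hxy⟩ := collapse_mem hl hl_sum hx
  exact (collapse_eq_iff hl hl_sum (mapsTo_mapG hu hl hu_sum hl_sum hx) (mapsTo_isoT hy)).2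
    (mapG_mem_fiber hl hl_sum (by linarith) (by linarith) (by linarith) hy hxy)

end semiconjugacy

end SwitchedServer

theorem proposition5 (u l : Fin 4 → ℝ) (hu : ∀ i, 0 < u i) (hl : ∀ i, 0 < l i)
    (hu_sum : ∑ i, u i = 1) (hl_sum : ∑ i, l i = 1 / 2)
    (hul : (fun i : Fin 3 => u i.castSucc) =
      SwitchedServer.matM.mulVec (fun j : Fin 3 => l j.castSucc) +
        (1 / 2 : ℝ) • (fun i : Fin 3 => SwitchedServer.coeffC i.castSucc 3)) :
    SwitchedServer.orbitSet.Countable ∧ SwitchedServer.orbitSet.Infinite ∧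
    SwitchedServer.orbitSet ⊆ Set.Icc 0 SwitchedServer.lamNorm ∧
    Set.Icc 0 SwitchedServer.lamNorm ⊆ closure SwitchedServer.orbitSet ∧
    ∃ h : ℝ → ℝ,
      SwitchedServer.IsSemiconjugacy SwitchedServer.lamNorm (SwitchedServer.mapG u l)
        SwitchedServer.isoT h ∧
      (∀ (i : Fin 4) (k : ℕ), ∃ a b : ℝ,
        {x ∈ Set.Icc (0 : ℝ) 1 | h x = SwitchedServer.isoT^[k] (SwitchedServer.pt i)} =
          Set.Icc a b ∧
        b - a = SwitchedServer.gapLength l i k) ∧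
      (∀ y ∈ Set.Icc 0 SwitchedServer.lamNorm, y ∉ SwitchedServer.orbitSet →
        ∃! x : ℝ, x ∈ Set.Icc (0 : ℝ) 1 ∧ h x = y) := by
  refine ⟨SwitchedServer.orbitSet_countable, SwitchedServer.orbitSet_infinite,
    SwitchedServer.orbitSet_subset, SwitchedServer.Icc_subset_closure_orbitSet,
    SwitchedServer.collapse l,
    SwitchedServer.isSemiconjugacy_collapse hu hl hu_sum hl_sum hul, fun i k => ?_,
    fun y hy hyo => ?_⟩
  · refine ⟨_, _, SwitchedServer.fiber_eq hl hl_sum (SwitchedServer.iterate_mem_Icc i k), ?_⟩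
    rw [SwitchedServer.mass_Iic, SwitchedServer.mass_singleton]
    ring
  · have h := SwitchedServer.fiber_eq hl hl_sum hy
    rw [SwitchedServer.mass_Iic, SwitchedServer.mass_singleton_of_notMem hyo, add_zero,
      Set.Icc_self] at h
    have h' (x : ℝ) : (x ∈ Set.Icc (0 : ℝ) 1 ∧ SwitchedServer.collapse l x = y) ↔
        x = SwitchedServer.mass l (Set.Iio y) := Set.ext_iff.1 h x
    simp only [h']
    exact existsUnique_eq
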